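/- Theorem (well-posedness of the pressure-robust enriched Galerkin scheme). Let $d\in\{2,3\}$ and $\sigma\in\mathbb R$. There is $\rho_0>0$, depending only on $d$ and $\sigma$, such that the following holds. Setting. Let $\Omega\subset\mathbb R^d$ be a bounded connected nonempty open set with $\operatorname{int}\overline\Omega=\Omega$ (for instance, a domain with Lipschitz boundary), and let $\mathcal T_h$ be a finite conforming mesh of $\overline\Omega$ into closed nondegenerate triangles ($d=2$) or tetrahedra ($d=3$) that is shape-regular with constant $\sigma$: every $K\in\mathcal T_h$ contains a ball of radius $r>0$ with $\operatorname{diam}K\le\sigma r$. Let $\mathcal E_h$ be the set of all edges ($d=2$) or faces ($d=3$) of the elements; $e\in\mathcal E_h$ is interior if it is shared by two different elements $K^+,K^-$, and a boundary edge/face otherwise, in which case $K^+$ denotes the element containing it. Let $n_e$ be the unit normal of $e$ pointing out of $K^+$, let $|e|$ be the length/area of $e$, and $h_e=|e|^{1/(d-1)}$. On interior $e$ put $\{v\}=\frac12(v^++v^-)$ and $[v]=v^+-v^-$, where $v^\pm$ is the trace of $v|_{K^\pm}$; on boundary $e$ put $\{v\}=[v]=v$. Let $$C_h=\{v\in[H^1_0(\Omega)]^d: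 v|_K\in[\mathbb P_1(K)]^d\ \forall K\in\mathcal T_h\},\qquad D_h=\{v: v|_K=c_K(x-x_K),\ c_K\in\mathbb R,\ \forall K\in\mathcal T_h\},$$ where $x_K$ is the centroid of $K$, and $$V_h=C_h+D_h,\qquad Q_h=\{q: q|_K\in\mathbb P_0(K)\ \forall K\in\mathcal T_h,\ \textstyle\int_\Omega q\,dx=0\},\qquad \mathrm{BDM}_1=\{w\in H(\mathrm{div},\Omega): w|_K\in[\mathbb P_1(K)]^d\ \forall K\in\mathcal T_h\}.$$ For $\nu,\rho>0$ let $$a(v,w)=\nu\Big(\sum_{K\in\mathcal T_h}\int_K\nabla v:\nabla w\,dx-\sum_{e\in\mathcal E_h}\int_e\{\nabla v\}n_e\cdot[w]\,ds-\sum_{e\in\mathcal E_h}\int_e\{\nabla w\}n_e\cdot[v]\,ds+\rho\sum_{e\in\mathcal E_h}\int_e h_e^{-1}[w]\cdot[v]\,ds\Big),$$ $$b(w,q)=\sum_{K\in\mathcal T_h}\int_K(\nabla\cdot w)\,q\,dx-\sum_{e\in\mathcal E_h}\int_e[w]\cdot n_e\,\{q\}\,ds.$$ Conclusion. (i) For every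 $v\in V_h$ there is exactly one $\mathcal Rv\in\mathrm{BDM}_1$ such that, for all $p_1\in\mathbb P_1(e)$, $\int_e\mathcal Rv\cdot n_e\,p_1\,ds=\int_e\{v\}\cdot n_e\,p_1\,ds$ on every interior $e$ and $\int_e\mathcal Rv\cdot n_e\,p_1\,ds=0$ on every boundary $e$. (ii) For all $\nu>0$, all $\rho\ge\rho_0$ and all $f\in[L^2(\Omega)]^d$ there is exactly one pair $(u_h,p_h)\in V_h\times Q_h$ such that $$a(u_h,v)-b(v,p_h)=(f,\mathcal Rv)_{L^2(\Omega)}\quad\forall v\in V_h,\qquad b(u_h,q)=0\quad\forall q\in Q_h.$$ -/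

import Mathlib

open MeasureTheory Set Filter Topology
open scoped ContDiff

noncomputable section

namespace StokesEG

/-- Euclidean space `ℝ^d`. -/
abbrev E (d : ℕ) : Type := EuclideanSpace ℝ (Fin d)

/-! ### Function spaces on an open set -/

/-- `φ ∈ C_c^∞(Ω; F)`. -/
def IsTestFunction {d : ℕ} {F : Type*} [NormedAddCommGroup F] [NormedSpace ℝ F]
    (Ω : Set (E d)) (φ : E d → F) : Prop :=
  ContDiff ℝ ∞ φ ∧ HasCompactSupport φ ∧ tsupport φ ⊆ Ω

/-- `G` is the weak gradient of the vector field `u` on `Ω`: `G x z` is the weak derivative of `u`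
in the direction `z`. -/
def IsWeakGradient {d : ℕ} (Ω : Set (E d)) (u : E d → E d) (G : E d → E d →L[ℝ] E d) : Prop :=
  ∀ φ : E d → ℝ, IsTestFunction Ω φ → ∀ z : E d,
    ∫ x in Ω, (fderiv ℝ φ x z) • u x = - ∫ x in Ω, φ x • G x z

/-- `u ∈ [H¹₀(Ω)]^d`: `u` has a weak gradient, both are square integrable on `Ω`, and `u` is a limit
in the `H¹` norm of smooth fields with compact support in `Ω`. -/
def MemH10 {d : ℕ} (Ω : Set (E d)) (u : E d → E d) : Prop :=
  MemLp u 2 (volume.restrict Ω) ∧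
  ∃ G : E d → E d →L[ℝ] E d,
    MemLp G 2 (volume.restrict Ω) ∧ IsWeakGradient Ω u G ∧
    ∃ φ : ℕ → E d → E d, (∀ n, IsTestFunction Ω (φ n)) ∧
      Tendsto (fun n => eLpNorm (fun x => φ n x - u x) 2 (volume.restrict Ω)) atTop (𝓝 0) ∧
      Tendsto (fun n => eLpNorm (fun x => fderiv ℝ (φ n) x - G x) 2 (volume.restrict Ω))
        atTop (𝓝 0)

/-- `w ∈ H(div, Ω)`: `w` and its weak divergence `g` are square integrable on `Ω`. -/
def MemHdiv {d : ℕ} (Ω : Set (E d)) (w : E d → E d) : Prop :=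
  MemLp w 2 (volume.restrict Ω) ∧
  ∃ g : E d → ℝ, MemLp g 2 (volume.restrict Ω) ∧
    ∀ φ : E d → ℝ, IsTestFunction Ω φ →
      ∫ x in Ω, fderiv ℝ φ x (w x) = - ∫ x in Ω, g x * φ x

/-! ### Simplicial meshes -/

/-- A conforming simplicial mesh of (the closure of) `Ω ⊆ ℝ^d`. An element is given by the set of
its `d + 1` affinely independent vertices; two elements meet in the simplex spanned by their common
vertices (possibly in the empty set). -/
structure Mesh (d : ℕ) (Ω : Set (E d)) where
  elems : Finset (Finset (E d))
  card_eq : ∀ K ∈ elems, K.card = d + 1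
  indep : ∀ K ∈ elems, AffineIndependent ℝ (fun x : K => (x : E d))
  inter_eq : ∀ K ∈ elems, ∀ L ∈ elems,
    convexHull ℝ (K : Set (E d)) ∩ convexHull ℝ (L : Set (E d))
      = convexHull ℝ ((K : Set (E d)) ∩ (L : Set (E d)))
  union_eq : ⋃ K ∈ elems, convexHull ℝ (K : Set (E d)) = closure Ω

namespace Mesh

variable {d : ℕ} {Ω : Set (E d)}

/-- Shape regularity with constant `σ`: every element `K` contains a ball of radius `r > 0` with
`h_K ≤ σ r`. -/
def IsShapeRegular (T : Mesh d Ω) (σ : ℝ) : Prop :=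
  ∀ K ∈ T.elems, ∃ (c : E d) (r : ℝ), 0 < r ∧
    Metric.closedBall c r ⊆ convexHull ℝ (K : Set (E d)) ∧
    Metric.diam (convexHull ℝ (K : Set (E d))) ≤ σ * r

open Classical in
/-- All edges (`d = 2`) or faces (`d = 3`) of the mesh, given by their `d` vertices. -/
def faces (T : Mesh d Ω) : Finset (Finset (E d)) :=
  T.elems.biUnion fun K => K.powersetCard d

/-- The face `e` is interior: it is shared by two different elements. The other faces are the
boundary faces. -/
def IsInterior (T : Mesh d Ω) (e : T.faces) : Prop :=
  ∃ K L : T.elems, K ≠ L ∧ e.1 ⊆ K.1 ∧ e.1 ⊆ L.1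

/-- `h_e = |e|^{1/(d-1)}`, where `|e|` is the length or area of `e`. -/
def faceSize (T : Mesh d Ω) (e : T.faces) : ℝ :=
  ((μHE[d - 1] : Measure (E d)).real (convexHull ℝ (e.1 : Set (E d)))) ^ (1 / ((d : ℝ) - 1))

/-- `∫_e g ds`, with respect to the length or area measure. -/
def faceIntegral (T : Mesh d Ω) (e : T.faces) (g : E d → ℝ) : ℝ :=
  ∫ x in convexHull ℝ (e.1 : Set (E d)), g x ∂(μHE[d - 1] : Measure (E d))

/-- `∫_K g dx`. -/
def elemIntegral (T : Mesh d Ω) (K : T.elems) (g : E d → ℝ) : ℝ :=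
  ∫ x in convexHull ℝ (K.1 : Set (E d)), g x

/-- `n` is the unit normal vector of the facet `e` of the simplex `K` that points out of `K`. -/
def IsOutwardNormal (K e : Finset (E d)) (n : E d) : Prop :=
  ‖n‖ = 1 ∧ (∀ x ∈ e, ∀ y ∈ e, inner ℝ n (x - y) = 0) ∧
    ∀ x ∈ e, ∀ a ∈ K, a ∉ e → inner ℝ n (a - x) < 0

/-- A choice, for every face `e`, of the names `K⁺`, `K⁻` of the elements that contain it and of the
unit normal `n_e`, which points out of `K⁺` (so for interior `e` from `K⁺` to `K⁻`, and for boundary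
faces out of the domain). The value of `minus` on boundary faces is never used. -/
structure Orientation (T : Mesh d Ω) where
  plus : T.faces → T.elems
  minus : T.faces → T.elems
  normal : T.faces → E d
  subset_plus : ∀ e, e.1 ⊆ (plus e).1
  subset_minus : ∀ e, e.1 ⊆ (minus e).1
  plus_ne_minus : ∀ e, T.IsInterior e → plus e ≠ minus e
  outward : ∀ e, IsOutwardNormal (plus e).1 e.1 (normal e)

/-! ### Piecewise polynomials

A piecewise polynomial function is given by its polynomial on each element; its trace from an
element `K` on a face of `K` is the value of the polynomial on `K`. -/

/-- Piecewise `[P₁]^d` vector fields. -/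
abbrev VecP1 (T : Mesh d Ω) : Type := T.elems → (E d →ᵃ[ℝ] E d)

/-- Piecewise `P₀` scalar functions. -/
abbrev ScalP0 (T : Mesh d Ω) : Type := T.elems → ℝ

open Classical in
/-- The function on `ℝ^d` that equals `g K` in the interior of each element `K` and vanishes
elsewhere (the element boundaries are a null set). -/
def glue {F : Type*} [AddCommGroup F] (T : Mesh d Ω) (g : T.elems → E d → F) : E d → F :=
  fun x => ∑ K : T.elems, (interior (convexHull ℝ (K.1 : Set (E d)))).indicator (g K) x

/-- The vector field on `ℝ^d` given by a piecewise `[P₁]^d` field. -/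
def vecFun (T : Mesh d Ω) (v : T.VecP1) : E d → E d := T.glue fun K x => v K x

/-- The function on `ℝ^d` given by a piecewise constant. -/
def scalFun (T : Mesh d Ω) (q : T.ScalP0) : E d → ℝ := T.glue fun K _ => q K

/-- The continuous velocity space `C_h`: piecewise `[P₁]^d` fields in `[H¹₀(Ω)]^d`. -/
def Ch (T : Mesh d Ω) : Set T.VecP1 := {v | MemH10 Ω (T.vecFun v)}

/-- The enrichment space `D_h`: fields that equal `c (x - x_K)` on each element `K`, where `x_K` is
the centroid of `K` and the real number `c` depends on `K`. -/
def Dh (T : Mesh d Ω) : Set T.VecP1 :=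
  {v | ∀ K : T.elems, ∃ c : ℝ, ∀ x, v K x = c • (x - K.1.centroid ℝ id)}

/-- The velocity space `V_h = C_h + D_h`. -/
def Vh (T : Mesh d Ω) : Set T.VecP1 := {v | ∃ vC ∈ T.Ch, ∃ vD ∈ T.Dh, v = vC + vD}

/-- The pressure space `Q_h`: piecewise constants with mean zero on `Ω`. -/
def Qh (T : Mesh d Ω) : Set T.ScalP0 := {q | ∫ x in Ω, T.scalFun q x = 0}

/-- The space `BDM₁`: piecewise `[P₁]^d` fields in `H(div, Ω)`. -/
def BDM1 (T : Mesh d Ω) : Set T.VecP1 := {w | MemHdiv Ω (T.vecFun w)}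

/-- The Frobenius product `∇v : ∇w` of two (constant) gradients. -/
def frob (L M : E d →ₗ[ℝ] E d) : ℝ :=
  ∑ i : Fin d, inner ℝ (L (EuclideanSpace.single i 1)) (M (EuclideanSpace.single i 1))

/-- The divergence of an affine vector field. -/
def divergence (A : E d →ᵃ[ℝ] E d) : ℝ := LinearMap.trace ℝ (E d) A.linear

namespace Orientation

variable {T : Mesh d Ω} {F : Type*} [AddCommGroup F] [Module ℝ F]

open Classical in
/-- The average on `e` of a quantity whose trace from the element `K` is `y K`. -/
def avg (O : T.Orientation) (e : T.faces) (y : T.elems → F) : F :=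
  if T.IsInterior e then (1 / 2 : ℝ) • (y (O.plus e) + y (O.minus e)) else y (O.plus e)

open Classical in
/-- The jump on `e` of a quantity whose trace from the element `K` is `y K`. -/
def jump (O : T.Orientation) (e : T.faces) (y : T.elems → F) : F :=
  if T.IsInterior e then y (O.plus e) - y (O.minus e) else y (O.plus e)

/-- `⟨{∇v} n_e, [w]⟩` over all faces. -/
def consistency (O : T.Orientation) (v w : T.VecP1) : ℝ :=
  ∑ e : T.faces, T.faceIntegral e fun x =>
    inner ℝ (O.avg e fun K => (v K).linear (O.normal e)) (O.jump e fun K => w K x)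

/-- The interior penalty bilinear form `a` with viscosity `ν` and penalty parameter `ρ`. -/
def a (O : T.Orientation) (ν ρ : ℝ) (v w : T.VecP1) : ℝ :=
  ν * ((∑ K : T.elems, T.elemIntegral K fun _ => frob (v K).linear (w K).linear)
    - O.consistency v w - O.consistency w v
    + ρ * ∑ e : T.faces, T.faceIntegral e fun x =>
        (T.faceSize e)⁻¹ * inner ℝ (O.jump e fun K => w K x) (O.jump e fun K => v K x))

/-- The bilinear form `b`. -/
def b (O : T.Orientation) (w : T.VecP1) (q : T.ScalP0) : ℝ :=
  (∑ K : T.elems, T.elemIntegral K fun _ => divergence (w K) * q K)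
    - ∑ e : T.faces, T.faceIntegral e fun x =>
        inner ℝ (O.jump e fun K => w K x) (O.normal e) * O.avg e q

/-- `w ∈ BDM₁` has the normal moments that define the reconstruction of `v`. The normal trace of `w`
on an interior face may be taken from either element, so both are required to have the moments. -/
def IsReconstruction (O : T.Orientation) (v w : T.VecP1) : Prop :=
  w ∈ T.BDM1 ∧
  (∀ e : T.faces, T.IsInterior e → ∀ K : T.elems, e.1 ⊆ K.1 → ∀ p : E d →ᵃ[ℝ] ℝ,
    T.faceIntegral e (fun x => inner ℝ (w K x) (O.normal e) * p x)
      = T.faceIntegral e (fun x =>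
          inner ℝ (O.avg e fun L => v L x) (O.normal e) * p x)) ∧
  (∀ e : T.faces, ¬ T.IsInterior e → ∀ K : T.elems, e.1 ⊆ K.1 → ∀ p : E d →ᵃ[ℝ] ℝ,
    T.faceIntegral e (fun x => inner ℝ (w K x) (O.normal e) * p x) = 0)

open Classical in
/-- The velocity reconstruction operator `𝓡`. -/
def recon (O : T.Orientation) (v : T.VecP1) : T.VecP1 :=
  if h : ∃ w, O.IsReconstruction v w then h.choose else 0

/-- `(u, p) ∈ V_h × Q_h` solves the pressure-robust enriched Galerkin scheme with body force `f`. -/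
def IsSolution (O : T.Orientation) (ν ρ : ℝ) (f : E d → E d) (u : T.VecP1) (p : T.ScalP0) : Prop :=
  u ∈ T.Vh ∧ p ∈ T.Qh ∧
  (∀ v ∈ T.Vh, O.a ν ρ u v - O.b v p = ∫ x in Ω, inner ℝ (f x) (T.vecFun (O.recon v) x)) ∧
  (∀ q ∈ T.Qh, O.b u q = 0)

end Orientation

end Mesh

end StokesEG

end

/-!
The scheme is a square linear system, so existence follows from uniqueness, which has two sources.

Coercivity of `a`. On an affine piece the gradient is constant, so shape regularity alone bounds
`∫ₑ hₑ |{∇v}|²` by a multiple of the energy on the adjacent elements: for `ρ` above a threshold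
depending on `d` and `σ` the penalty absorbs the consistency terms. What remains controls the
gradients and the jumps, which include the boundary values. They can only vanish together if
`v = 0`, because any two elements are joined by a chain of elements in which consecutive ones share
a face: the parts of the mesh of codimension two are too thin to separate the connected set `Ω`.

Injectivity of `b` in the pressure. The field `c_K (x - x_K)` has constant normal component on each
face of `K`. Testing with it therefore shows that a pressure annihilated by all velocities has the
same value on neighbouring elements, so that it is constant, hence zero by its vanishing mean.

The reconstruction exists because the values at a vertex of `K` of an affine field are determined by
their components along the normals of the `d` faces through that vertex. The normal components on
the faces of `K` can thus be prescribed independently, as arbitrary affine functions.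
-/

namespace StokesEG

/-! ### Integration over cones -/

section Cone

variable {V : Type*} [NormedAddCommGroup V] [InnerProductSpace ℝ V]

/-- The isometric parametrization of the hyperplane through `p` orthogonal to `N`. -/
noncomputable def hyperplaneMap (N p : V) (z : (ℝ ∙ N)ᗮ) : V := p + z

lemma inner_orthogonal_span_singleton {N : V} (z : (ℝ ∙ N)ᗮ) : inner ℝ N (z : V) = 0 :=
  Submodule.mem_orthogonal_singleton_iff_inner_right.1 z.2

lemma isometry_hyperplaneMap (N p : V) : Isometry (hyperplaneMap N p) :=
  (isometry_add_left p).comp isometry_subtype_coe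

lemma mem_range_hyperplaneMap {N p y : V} :
    y ∈ range (hyperplaneMap N p) ↔ inner ℝ N (y - p) = 0 := by
  constructor
  · rintro ⟨z, rfl⟩
    simpa [hyperplaneMap] using inner_orthogonal_span_singleton z
  · intro h
    exact ⟨⟨y - p, Submodule.mem_orthogonal_singleton_iff_inner_right.2 h⟩, by simp [hyperplaneMap]⟩

/-- The cone with apex `a` over `S`. -/
def cone (a : V) (S : Set V) : Set V :=
  (fun x : ℝ × V => a + x.1 • (x.2 - a)) '' (Icc 0 1 ×ˢ S)

lemma isCompact_cone (a : V) {S : Set V} (hS : IsCompact S) : IsCompact (cone a S) :=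
  (isCompact_Icc.prod hS).image (by fun_prop)

lemma convexHull_insert_eq_cone {s : Set V} (hs : s.Nonempty) (a : V) :
    convexHull ℝ (insert a s) = cone a (convexHull ℝ s) := by
  rw [convexHull_insert hs, convexJoin_singleton_left]
  ext x
  simp only [mem_iUnion, segment_eq_image', cone, mem_image, mem_prod, Prod.exists]
  constructor
  · rintro ⟨y, hy, t, ht, rfl⟩
    exact ⟨t, y, ⟨ht, hy⟩, rfl⟩
  · rintro ⟨t, y, ⟨ht, hy⟩, rfl⟩
    exact ⟨y, hy, t, ht, rfl⟩

/-- Cartesian coordinates `(t, z) ↦ a + t N + z` along and orthogonal to the unit vector `N`. -/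
noncomputable def axisMap (N a : V) (x : ℝ × (ℝ ∙ N)ᗮ) : V := a + x.1 • N + x.2

lemma axisMap_mem_cone_iff {N a : V} (hN : ‖N‖ = 1) {η : ℝ} (hη : 0 < η) {S : Set V}
    (hS : ∀ y ∈ S, inner ℝ N (y - a) = η) {s : ℝ} (hs : s ≠ 0) (z : (ℝ ∙ N)ᗮ) :
    axisMap N a (η * s, z) ∈ cone a S ↔
      s ∈ Ioc 0 1 ∧ s⁻¹ • z ∈ hyperplaneMap N (a + η • N) ⁻¹' S := by
  have hNN : inner ℝ N N = 1 := by rw [real_inner_self_eq_norm_sq, hN, one_pow]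
  constructor
  · rintro ⟨⟨t, y⟩, ⟨ht, hy⟩, h⟩
    simp only [axisMap, add_assoc, add_right_inj] at h
    obtain rfl : t = s := by
      have := congrArg (inner ℝ N) h
      rw [inner_smul_right, hS y hy, inner_add_right, inner_smul_right, hNN,
        inner_orthogonal_span_singleton, add_zero, mul_one, mul_comm] at this
      exact mul_left_cancel₀ hη.ne' this
    have hyz : y = a + η • N + t⁻¹ • (z : V) := by
      rw [add_assoc, ← sub_eq_iff_eq_add', ← inv_smul_smul₀ hs (y - a), h, smul_add, smul_smul,
        mul_comm η, inv_mul_cancel_left₀ hs]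
    exact ⟨⟨lt_of_le_of_ne ht.1 hs.symm, ht.2⟩, by simpa [hyperplaneMap, ← hyz] using hy⟩
  · rintro ⟨⟨h0, h1⟩, h⟩
    refine ⟨(s, a + η • N + s⁻¹ • (z : V)), ⟨⟨h0.le, h1⟩, by simpa [hyperplaneMap] using h⟩, ?_⟩
    simp only [axisMap, add_assoc, add_sub_cancel_left, smul_add, smul_smul, mul_inv_cancel₀ hs,
      one_smul, mul_comm]

lemma hasDerivAt_pow_smul_ray {F : Type*} [NormedAddCommGroup F] [NormedSpace ℝ F]
    {f : V → F} {a v : V} {m : ℕ} (hm : m ≠ 0) {s : ℝ}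
    (hf : DifferentiableAt ℝ f (a + s • v)) :
    HasDerivAt (fun s : ℝ => s ^ m • f (a + s • v))
      (s ^ (m - 1) • ((m : ℝ) • f (a + s • v) + fderiv ℝ f (a + s • v) (a + s • v - a))) s := by
  have hray : HasDerivAt (fun s : ℝ => a + s • v) v s := by
    simpa using ((hasDerivAt_id s).smul_const v).const_add a
  have hprod := (hasDerivAt_pow m s).smul (hf.hasFDerivAt.comp_hasDerivAt s hray)
  refine hprod.congr_deriv ?_
  simp only [add_sub_cancel_left, map_smul, smul_add, smul_smul, Function.comp_apply,
    pow_sub_one_mul hm, mul_comm (m : ℝ)]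
  exact add_comm _ _

lemma integral_pow_smul_ray {F : Type*} [NormedAddCommGroup F] [NormedSpace ℝ F] [CompleteSpace F]
    {f : V → F} (hf : ContDiff ℝ 1 f) {m : ℕ} (hm : m ≠ 0) (a v : V) :
    ∫ s in (0 : ℝ)..1,
      s ^ (m - 1) • ((m : ℝ) • f (a + s • v) + fderiv ℝ f (a + s • v) (a + s • v - a))
      = f (a + v) := by
  have hfc := hf.continuous
  have : Continuous (fderiv ℝ f) := hf.continuous_fderiv one_ne_zero
  rw [intervalIntegral.integral_eq_sub_of_hasDerivAt
    (fun s _ => hasDerivAt_pow_smul_ray hm (hf.differentiable one_ne_zero (a + s • v)))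
    (Continuous.intervalIntegrable (by fun_prop) _ _)]
  simp [hm]

variable [FiniteDimensional ℝ V]

lemma finrank_orthogonal_span_singleton {N : V} (hN : N ≠ 0) :
    Module.finrank ℝ (ℝ ∙ N)ᗮ = Module.finrank ℝ V - 1 := by
  rw [← (ℝ ∙ N).finrank_add_finrank_orthogonal, finrank_span_singleton hN, Nat.add_sub_cancel_left]

variable [MeasurableSpace V] [BorelSpace V]

lemma measurableEmbedding_hyperplaneMap (N p : V) : MeasurableEmbedding (hyperplaneMap N p) :=
  (isometry_hyperplaneMap N p).isClosedEmbedding.measurableEmbedding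

lemma map_hyperplaneMap_volume {N : V} (hN : N ≠ 0) (p : V) :
    (volume : Measure (ℝ ∙ N)ᗮ).map (hyperplaneMap N p)
      = (μHE[Module.finrank ℝ V - 1] : Measure V).restrict (range (hyperplaneMap N p)) := by
  rw [← finrank_orthogonal_span_singleton hN,
    ← InnerProductSpace.euclideanHausdorffMeasure_eq_volume]
  exact (isometry_hyperplaneMap N p).map_euclideanHausdorffMeasure

lemma euclideanHausdorffMeasure_restrict_hyperplane {N : V} (hN : N ≠ 0) (p : V) {S : Set V}
    (hSm : MeasurableSet S) (hS : ∀ y ∈ S, inner ℝ N (y - p) = 0) :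
    (μHE[Module.finrank ℝ V - 1] : Measure V).restrict S
      = ((volume : Measure (ℝ ∙ N)ᗮ).map (hyperplaneMap N p)).restrict S := by
  rw [map_hyperplaneMap_volume hN, Measure.restrict_restrict hSm,
    inter_eq_left.2 fun y hy => mem_range_hyperplaneMap.2 (hS y hy)]

lemma setIntegral_hyperplane {F : Type*} [NormedAddCommGroup F] [NormedSpace ℝ F] {N : V}
    (hN : N ≠ 0) (p : V) {S : Set V} (hSm : MeasurableSet S)
    (hS : ∀ y ∈ S, inner ℝ N (y - p) = 0) (f : V → F) :
    ∫ y in S, f y ∂(μHE[Module.finrank ℝ V - 1] : Measure V)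
      = ∫ z in hyperplaneMap N p ⁻¹' S, f (p + z) := by
  rw [euclideanHausdorffMeasure_restrict_hyperplane hN p hSm hS,
    (measurableEmbedding_hyperplaneMap N p).setIntegral_map]
  rfl

lemma euclideanHausdorffMeasure_lt_top_of_subset_hyperplane {N : V} (hN : N ≠ 0) (p : V)
    {S : Set V} (hSc : IsCompact S) (hS : ∀ y ∈ S, inner ℝ N (y - p) = 0) :
    (μHE[Module.finrank ℝ V - 1] : Measure V) S < ⊤ := by
  rw [← Measure.restrict_apply_self,
    euclideanHausdorffMeasure_restrict_hyperplane hN p hSc.measurableSet hS,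
    Measure.restrict_apply_self, (measurableEmbedding_hyperplaneMap N p).map_apply]
  exact ((isometry_hyperplaneMap N p).isClosedEmbedding.isCompact_preimage hSc).measure_lt_top

lemma axisMap_eq_comp {N : V} (hN : ‖N‖ = 1) (a : V) :
    axisMap N a = ((ℝ ∙ N).measurableEquivProd a).symm ∘
      Prod.map (LinearIsometryEquiv.toSpanUnitSingleton (𝕜 := ℝ) N hN) id := by
  ext1 x
  simp [axisMap, add_comm, add_left_comm]

lemma measurableEmbedding_axisMap {N : V} (hN : ‖N‖ = 1) (a : V) :
    MeasurableEmbedding (axisMap N a) := by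
  rw [axisMap_eq_comp hN]
  let axis := (LinearIsometryEquiv.toSpanUnitSingleton (𝕜 := ℝ) N hN).toHomeomorph
  exact (MeasurableEquiv.measurableEmbedding _).comp (axis.measurableEmbedding.prodMap .id)

lemma measurePreserving_axisMap {N : V} (hN : ‖N‖ = 1) (a : V) :
    MeasurePreserving (axisMap N a) := by
  have h := ((ℝ ∙ N).measurePreserving_measurableEquivProd a).symm.comp
    ((LinearIsometryEquiv.toSpanUnitSingleton (𝕜 := ℝ) N hN).measurePreserving.prod
      (MeasurePreserving.id (volume : Measure (ℝ ∙ N)ᗮ)))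
  rw [InnerProductSpace.euclideanHausdorffMeasure_eq_volume] at h
  exact axisMap_eq_comp hN a ▸ h

variable {F : Type*} [NormedAddCommGroup F] [NormedSpace ℝ F]

lemma integral_axisMap {N : V} (hN : ‖N‖ = 1) (a : V) {g : V → F} (hg : Integrable g) :
    ∫ x, g x = ∫ t, ∫ z, g (axisMap N a (t, z)) := by
  have hmp := measurePreserving_axisMap hN a
  rw [← hmp.integral_comp (measurableEmbedding_axisMap hN a), Measure.volume_eq_prod]
  exact integral_prod _ ((hmp.integrable_comp_emb (measurableEmbedding_axisMap hN a)).2 hg)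

lemma integral_indicator_cone_slice {N a : V} (hN : ‖N‖ = 1) {η : ℝ} (hη : 0 < η) {S : Set V}
    (hSm : MeasurableSet S) (hS : ∀ y ∈ S, inner ℝ N (y - a) = η) (g : V → F) {s : ℝ}
    (hs : s ≠ 0) :
    ∫ z, (cone a S).indicator g (axisMap N a (η * s, z))
      = (Ioc (0 : ℝ) 1).indicator (fun s => s ^ (Module.finrank ℝ V - 1) •
          ∫ z in hyperplaneMap N (a + η • N) ⁻¹' S, g (a + s • (η • N + (z : V)))) s := by
  have hN0 : N ≠ 0 := norm_ne_zero_iff.1 (by simp [hN])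
  have hmem := axisMap_mem_cone_iff hN hη hS hs
  by_cases h01 : s ∈ Ioc (0 : ℝ) 1
  · have hpre : MeasurableSet (hyperplaneMap N (a + η • N) ⁻¹' S) :=
      (measurableEmbedding_hyperplaneMap N _).measurable hSm
    have hslice (z : (ℝ ∙ N)ᗮ) : (cone a S).indicator g (axisMap N a (η * s, z))
        = (hyperplaneMap N (a + η • N) ⁻¹' S).indicator
          (fun z => g (a + s • (η • N + (z : V)))) (s⁻¹ • z) := by
      by_cases hz : s⁻¹ • z ∈ hyperplaneMap N (a + η • N) ⁻¹' S
      · rw [indicator_of_mem hz, indicator_of_mem ((hmem z).2 ⟨h01, hz⟩)]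
        simp only [axisMap, Submodule.coe_smul, smul_add, smul_smul, mul_inv_cancel₀ hs, one_smul,
          add_assoc, mul_comm]
      · rw [indicator_of_notMem hz, indicator_of_notMem fun h => hz ((hmem z).1 h).2]
    simp only [hslice]
    rw [indicator_of_mem h01, Measure.integral_comp_inv_smul_of_nonneg _ _ h01.1.le,
      finrank_orthogonal_span_singleton hN0, integral_indicator hpre]
  · have hslice (z : (ℝ ∙ N)ᗮ) : (cone a S).indicator g (axisMap N a (η * s, z)) = 0 :=
      indicator_of_notMem (fun h => h01 ((hmem z).1 h).1) _
    simp only [hslice, integral_zero, indicator_of_notMem h01]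

lemma setIntegral_cone {N a : V} (hN : ‖N‖ = 1) {η : ℝ} (hη : 0 < η)
    {S : Set V} (hSc : IsCompact S) (hS : ∀ y ∈ S, inner ℝ N (y - a) = η) {g : V → F}
    (hg : IntegrableOn g (cone a S)) :
    ∫ x in cone a S, g x = η • ∫ s in (0 : ℝ)..1, s ^ (Module.finrank ℝ V - 1) •
      ∫ z in hyperplaneMap N (a + η • N) ⁻¹' S, g (a + s • (η • N + (z : V))) := by
  have hcone := (isCompact_cone a hSc).measurableSet
  set G : ℝ → F := fun t => ∫ z, (cone a S).indicator g (axisMap N a (t, z))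
  have hscale : ∫ t, G t = η • ∫ s, G (η * s) := by
    rw [Measure.integral_comp_mul_left, abs_of_pos (inv_pos.2 hη), smul_inv_smul₀ hη.ne']
  have hne : ∀ᵐ s : ℝ, s ≠ 0 := by simp [ae_iff]
  rw [← integral_indicator hcone, integral_axisMap hN a ((integrable_indicator_iff hcone).2 hg),
    hscale, intervalIntegral.integral_of_le zero_le_one, ← integral_indicator measurableSet_Ioc]
  congr 1
  refine integral_congr_ae ?_
  filter_upwards [hne] with s hs
  exact integral_indicator_cone_slice hN hη hSc.measurableSet hS g hs

/-- On each ray from `a` the integrand, weighted by the Jacobian `s ^ (dim V - 1)`, is the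
derivative of `s ^ dim V • f (a + s v)`. -/
theorem setIntegral_cone_radial [CompleteSpace F] {N a : V} (hN : ‖N‖ = 1) {η : ℝ} (hη : 0 < η)
    {S : Set V} (hSc : IsCompact S) (hS : ∀ y ∈ S, inner ℝ N (y - a) = η) {f : V → F}
    (hf : ContDiff ℝ 1 f) :
    ∫ x in cone a S, ((Module.finrank ℝ V : ℝ) • f x + fderiv ℝ f x (x - a))
      = η • ∫ y in S, f y ∂(μHE[Module.finrank ℝ V - 1] : Measure V) := by
  have hN0 : N ≠ 0 := norm_ne_zero_iff.1 (by simp [hN])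
  have : Nontrivial V := ⟨N, 0, hN0⟩
  have : Continuous (fderiv ℝ f) := hf.continuous_fderiv one_ne_zero
  have hfc := hf.continuous
  have hcont : Continuous fun x => (Module.finrank ℝ V : ℝ) • f x + fderiv ℝ f x (x - a) := by
    fun_prop
  have hp : ∀ y ∈ S, inner ℝ N (y - (a + η • N)) = 0 := fun y hy => by
    rw [← sub_sub, inner_sub_right, hS y hy, inner_smul_right, real_inner_self_eq_norm_sq, hN]
    ring
  have hB : IsCompact (hyperplaneMap N (a + η • N) ⁻¹' S) :=
    (isometry_hyperplaneMap N _).isClosedEmbedding.isCompact_preimage hSc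
  rw [setIntegral_cone hN hη hSc hS
      (hcont.continuousOn.integrableOn_compact (isCompact_cone a hSc)),
    setIntegral_hyperplane hN0 _ hSc.measurableSet hp]
  simp only [← integral_smul]
  rw [intervalIntegral.integral_of_le zero_le_one, integral_integral_swap]
  · rw [← integral_smul]
    refine setIntegral_congr_fun hB.measurableSet fun z _ => ?_
    rw [← intervalIntegral.integral_of_le zero_le_one, integral_pow_smul_ray hf
      Module.finrank_pos.ne', add_assoc]
  · rw [Measure.prod_restrict]
    refine IntegrableOn.mono_set (t := Icc 0 1 ×ˢ _) ?_ (prod_mono_left Ioc_subset_Icc_self)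
    refine ContinuousOn.integrableOn_compact (isCompact_Icc.prod hB) (Continuous.continuousOn ?_)
    fun_prop

end Cone

/-! ### Simplices -/

section AffineMap

variable {V F : Type*} [NormedAddCommGroup V] [NormedSpace ℝ V] [FiniteDimensional ℝ V]
  [NormedAddCommGroup F] [NormedSpace ℝ F]

lemma hasFDerivAt_affineMap (w : V →ᵃ[ℝ] F) (x : V) :
    HasFDerivAt w (LinearMap.toContinuousLinearMap w.linear) x := by
  have hw : ⇑w = fun x => LinearMap.toContinuousLinearMap w.linear x + w 0 := by
    ext1 x
    exact congrFun (AffineMap.decomp w) x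
  rw [hw]
  exact (ContinuousLinearMap.hasFDerivAt _).add_const _

lemma contDiff_affineMap (w : V →ᵃ[ℝ] F) {k : WithTop ℕ∞} : ContDiff ℝ k w := by
  rw [AffineMap.decomp w]
  exact (LinearMap.toContinuousLinearMap w.linear).contDiff.add contDiff_const

end AffineMap

lemma eqOn_convexHull_affineMap {V W : Type*} [AddCommGroup V] [Module ℝ V] [AddCommGroup W]
    [Module ℝ W] {f g : V →ᵃ[ℝ] W} {s : Set V} (h : EqOn f g s) : EqOn f g (convexHull ℝ s) :=
  (AffineMap.eqOn_affineSpan h).mono (convexHull_subset_affineSpan s)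

section Barycentric

variable {ι V : Type*} [AddCommGroup V] [Module ℝ V] (b : AffineBasis ι ℝ V)

lemma coord_linear_sub (i : ι) (x y : V) :
    (b.coord i).linear (x - y) = b.coord i x - b.coord i y :=
  (b.coord i).linearMap_vsub x y

variable [Fintype ι]

lemma sum_coord_linear (w : V) : ∑ i, (b.coord i).linear w = 0 := by
  have h (i : ι) : (b.coord i).linear w = b.coord i w - b.coord i 0 := by
    rw [← coord_linear_sub, sub_zero]
  simp only [h, Finset.sum_sub_distrib, b.sum_coord_apply_eq_one, sub_self]

lemma sum_coord_linear_smul (w x : V) : ∑ i, (b.coord i).linear w • (b i - x) = w := by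
  have h (i : ι) : (b.coord i).linear w = b.coord i w - b.coord i 0 := by
    rw [← coord_linear_sub, sub_zero]
  simp only [smul_sub, Finset.sum_sub_distrib]
  rw [← Finset.sum_smul, sum_coord_linear, zero_smul, sub_zero]
  simp only [h, sub_smul, Finset.sum_sub_distrib, b.linear_combination_coord_eq_self, sub_zero]

lemma trace_eq_sum_coord_linear (L : V →ₗ[ℝ] V) (x : V) :
    LinearMap.trace ℝ V L = ∑ i, (b.coord i).linear (L (b i - x)) := by
  have : Module.Finite ℝ V := .of_basis (b.basisOf b.nonempty.some)
  have hL : L = ∑ i, ((b.coord i).linear).smulRight (L (b i - x)) := by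
    ext1 w
    nth_rewrite 1 [← sum_coord_linear_smul b w x]
    simp only [map_sum, map_smul, LinearMap.sum_apply, LinearMap.smulRight_apply]
  nth_rewrite 1 [hL]
  simp only [map_sum, LinearMap.trace_smulRight]

end Barycentric

section Simplex

variable {ι V : Type*} [NormedAddCommGroup V] [InnerProductSpace ℝ V]

/-- The facet of the simplex spanned by `b` opposite to the vertex `b i`. -/
def facet (b : AffineBasis ι ℝ V) (i : ι) : Set V := convexHull ℝ (b '' {i}ᶜ)

lemma facet_subset (b : AffineBasis ι ℝ V) (i : ι) : facet b i ⊆ convexHull ℝ (range b) :=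
  convexHull_mono (image_subset_range _ _)

lemma isCompact_facet [Finite ι] (b : AffineBasis ι ℝ V) (i : ι) : IsCompact (facet b i) :=
  (toFinite _).isCompact_convexHull ℝ

lemma isCompact_simplex [Finite ι] (b : AffineBasis ι ℝ V) : IsCompact (convexHull ℝ (range b)) :=
  (toFinite _).isCompact_convexHull ℝ

lemma interior_simplex_nonempty [FiniteDimensional ℝ V] (b : AffineBasis ι ℝ V) :
    (interior (convexHull ℝ (range b))).Nonempty :=
  interior_convexHull_nonempty_iff_affineSpan_eq_top.2 b.tot

lemma subset_closure_interior_simplex [FiniteDimensional ℝ V] (b : AffineBasis ι ℝ V) :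
    convexHull ℝ (range b) ⊆ closure (interior (convexHull ℝ (range b))) := by
  rw [(convex_convexHull ℝ _).closure_interior_eq_closure_of_nonempty_interior
    (interior_simplex_nonempty b)]
  exact subset_closure

lemma coord_eq_zero_of_mem_facet {b : AffineBasis ι ℝ V} {i : ι} {x : V} (hx : x ∈ facet b i) :
    b.coord i x = 0 := by
  refine eqOn_convexHull_affineMap (f := b.coord i) (g := AffineMap.const ℝ V (0 : ℝ)) ?_ hx
  rintro _ ⟨j, hj, rfl⟩
  exact b.coord_apply_ne (Ne.symm hj)

lemma simplex_eq_cone [Nontrivial ι] (b : AffineBasis ι ℝ V) (i : ι) :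
    convexHull ℝ (range b) = cone (b i) (facet b i) := by
  have hrange : range b = insert (b i) (b '' {i}ᶜ) := by
    rw [← image_insert_eq, ← image_univ, insert_eq, union_compl_self]
  rw [hrange, facet, convexHull_insert_eq_cone (Set.nonempty_compl_of_nontrivial i |>.image b)]

lemma exists_mem_facet_coord_pos [Finite ι] [Nontrivial ι] (b : AffineBasis ι ℝ V) (i : ι) :
    ∃ z ∈ facet b i, ∀ j ≠ i, 0 < b.coord j z := by
  classical
  have := Fintype.ofFinite ι
  set s : Finset ι := {i}ᶜ with hs
  obtain ⟨k, hk⟩ := exists_ne i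
  have hne : s.Nonempty := ⟨k, by simpa [hs] using hk⟩
  refine ⟨s.centroid ℝ b, ?_, fun j hj => ?_⟩
  · rw [Finset.centroid_eq_centerMass _ hne]
    refine Finset.centerMass_mem_convexHull _ (fun j _ => by simp [Finset.centroidWeights]) ?_
      fun j hj => mem_image_of_mem b (by simpa [hs] using hj)
    rw [s.sum_centroidWeights_eq_one_of_nonempty ℝ hne]
    exact one_pos
  · rw [b.coord_apply_centroid (by simpa [hs] using hj)]
    have := hne.card_pos
    positivity

lemma exists_lineMap_mem_simplex [Finite ι] {b : AffineBasis ι ℝ V} {i : ι} {z p : V}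
    (hz : z ∈ facet b i) (hzpos : ∀ j ≠ i, 0 < b.coord j z) (hp : 0 ≤ b.coord i p) :
    ∃ t ∈ Ioo (0 : ℝ) 1, AffineMap.lineMap z p t ∈ convexHull ℝ (range b) := by
  have hline (j : ι) (t : ℝ) : b.coord j (AffineMap.lineMap z p t)
      = (1 - t) * b.coord j z + t * b.coord j p := by
    rw [AffineMap.apply_lineMap, AffineMap.lineMap_apply_ring]
  have hnonneg : ∀ᶠ t : ℝ in 𝓝[>] 0, ∀ j, 0 ≤ b.coord j (AffineMap.lineMap z p t) := by
    refine eventually_all.2 fun j => ?_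
    simp only [hline]
    rcases eq_or_ne j i with rfl | hj
    · filter_upwards [self_mem_nhdsWithin] with t ht
      rw [coord_eq_zero_of_mem_facet hz, mul_zero, zero_add]
      exact mul_nonneg (le_of_lt ht) hp
    · have hcont : Tendsto (fun t : ℝ => (1 - t) * b.coord j z + t * b.coord j p) (𝓝[>] 0)
          (𝓝 ((1 - 0) * b.coord j z + 0 * b.coord j p)) :=
        (Continuous.tendsto (by fun_prop) 0).mono_left nhdsWithin_le_nhds
      refine (hcont.eventually (lt_mem_nhds ?_)).mono fun t => le_of_lt
      simpa using hzpos j hj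
  obtain ⟨t, ht, ht01⟩ := (hnonneg.and (Ioo_mem_nhdsGT (zero_lt_one' ℝ))).exists
  exact ⟨t, ht01, by rw [b.convexHull_eq_nonneg_coord]; exact ht⟩

/-- Otherwise a point slightly beyond the middle of the facet, in the direction of `c k`, would
belong to both simplices but not to the facet. -/
lemma coord_neg_of_inter_subset_facet [Finite ι] [Nontrivial ι] {κ : Type*}
    {b : AffineBasis ι ℝ V} {i : ι} {c : AffineBasis κ ℝ V} {k : κ} (hfacet : facet c k = facet b i)
    (hinter : convexHull ℝ (range b) ∩ convexHull ℝ (range c) ⊆ facet b i) :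
    b.coord i (c k) < 0 := by
  by_contra! hck
  obtain ⟨z, hz, hzpos⟩ := exists_mem_facet_coord_pos b i
  obtain ⟨t, ht, htb⟩ := exists_lineMap_mem_simplex hz hzpos hck
  have hzc : z ∈ facet c k := hfacet ▸ hz
  have htc : AffineMap.lineMap z (c k) t ∈ convexHull ℝ (range c) :=
    (convex_convexHull ℝ _).lineMap_mem (facet_subset c k hzc)
      (subset_convexHull ℝ _ (mem_range_self k)) ⟨ht.1.le, ht.2.le⟩
  have hzero := coord_eq_zero_of_mem_facet (hfacet ▸ hinter ⟨htb, htc⟩)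
  rw [AffineMap.apply_lineMap, AffineMap.lineMap_apply_ring, coord_eq_zero_of_mem_facet hzc,
    c.coord_apply_eq, mul_zero, zero_add, mul_one] at hzero
  exact ht.1.ne' hzero

variable [FiniteDimensional ℝ V] (b : AffineBasis ι ℝ V) (i : ι)

/-- The gradient of the barycentric coordinate that equals one at `b i`. -/
noncomputable def coordGradient : V :=
  (InnerProductSpace.toDual ℝ V).symm (LinearMap.toContinuousLinearMap (b.coord i).linear)

/-- The height of the simplex spanned by `b` over the facet opposite to `b i`. -/
noncomputable def height : ℝ := ‖coordGradient b i‖⁻¹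

/-- The unit normal vector, pointing out of the simplex, of the facet opposite to `b i`. -/
noncomputable def outwardNormal : V := -(height b i • coordGradient b i)

lemma inner_coordGradient (w : V) : inner ℝ (coordGradient b i) w = (b.coord i).linear w := by
  simp [coordGradient, InnerProductSpace.toDual_symm_apply]

lemma inner_outwardNormal (w : V) :
    inner ℝ (outwardNormal b i) w = -(height b i * (b.coord i).linear w) := by
  rw [outwardNormal, inner_neg_left, real_inner_smul_left, inner_coordGradient]

variable {b i} in
lemma inner_outwardNormal_sub_vertex {y : V} (hy : y ∈ facet b i) :
    inner ℝ (outwardNormal b i) (y - b i) = height b i := by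
  rw [inner_outwardNormal, coord_linear_sub, coord_eq_zero_of_mem_facet hy, b.coord_apply_eq]
  ring

variable [Nontrivial ι]

lemma coordGradient_ne_zero : coordGradient b i ≠ 0 := by
  intro h
  obtain ⟨j, hj⟩ := exists_ne i
  have := inner_coordGradient b i (b i - b j)
  rw [h, inner_zero_left, coord_linear_sub, b.coord_apply_eq, b.coord_apply_ne hj.symm] at this
  norm_num at this

lemma height_pos : 0 < height b i := inv_pos.2 (norm_pos_iff.2 (coordGradient_ne_zero b i))

lemma norm_outwardNormal : ‖outwardNormal b i‖ = 1 := by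
  rw [outwardNormal, norm_neg, norm_smul, Real.norm_of_nonneg (height_pos b i).le, height,
    inv_mul_cancel₀ (norm_ne_zero_iff.2 (coordGradient_ne_zero b i))]

variable {b i} in
lemma eq_outwardNormal [Finite ι] {N : V} (hN : ‖N‖ = 1)
    (hfacet : ∀ j ≠ i, ∀ k ≠ i, inner ℝ N (b j - b k) = 0)
    (hvertex : ∀ j ≠ i, inner ℝ N (b i - b j) < 0) : N = outwardNormal b i := by
  have := Fintype.ofFinite ι
  obtain ⟨j, hj⟩ := exists_ne i
  have hinner (w : V) : inner ℝ N w = (b.coord i).linear w * inner ℝ N (b i - b j) := by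
    nth_rewrite 1 [← sum_coord_linear_smul b w (b j)]
    rw [inner_sum, Finset.sum_eq_single i, inner_smul_right]
    · intro k _ hk
      rw [inner_smul_right, hfacet k hk j hj, mul_zero]
    · simp
  set η := -inner ℝ N (b i - b j) with hη
  have hη0 : 0 < η := neg_pos.2 (hvertex j hj)
  have hgrad : N = -(η • coordGradient b i) := by
    refine ext_inner_right ℝ fun w => ?_
    rw [hinner, inner_neg_left, real_inner_smul_left, inner_coordGradient, hη]
    ring
  rw [hgrad, norm_neg, norm_smul, Real.norm_of_nonneg hη0.le] at hN
  rw [hgrad, outwardNormal, height, eq_inv_of_mul_eq_one_left hN]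

variable {b i} in
lemma outwardNormal_eq_neg_of_inter_subset_facet [Finite ι] {κ : Type*} [Finite κ]
    [Nontrivial κ] {c : AffineBasis κ ℝ V} {k : κ}
    (hfacet : facet c k = facet b i)
    (hinter : convexHull ℝ (range b) ∩ convexHull ℝ (range c) ⊆ facet b i) :
    outwardNormal c k = -outwardNormal b i := by
  have hcoord {j : κ} (hj : j ≠ k) : b.coord i (c j) = 0 :=
    coord_eq_zero_of_mem_facet (hfacet ▸ subset_convexHull ℝ _ (mem_image_of_mem c hj))
  refine (eq_outwardNormal ?_ (fun j hj l hl => ?_) fun j hj => ?_).symm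
  · rw [norm_neg, norm_outwardNormal]
  · rw [inner_neg_left, inner_outwardNormal, coord_linear_sub, hcoord hj, hcoord hl]
    simp
  · rw [inner_neg_left, inner_outwardNormal, neg_neg, coord_linear_sub, hcoord hj, sub_zero]
    exact mul_neg_of_pos_of_neg (height_pos b i) (coord_neg_of_inter_subset_facet hfacet hinter)

variable [MeasurableSpace V] [BorelSpace V]

lemma euclideanHausdorffMeasure_facet_lt_top [Finite ι] :
    (μHE[Module.finrank ℝ V - 1] : Measure V) (facet b i) < ⊤ := by
  refine euclideanHausdorffMeasure_lt_top_of_subset_hyperplane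
    (N := outwardNormal b i) (norm_ne_zero_iff.1 (by simp [norm_outwardNormal b i]))
    (b i + height b i • outwardNormal b i)
    (isCompact_facet b i) fun y hy => ?_
  rw [← sub_sub, inner_sub_right, inner_outwardNormal_sub_vertex hy, inner_smul_right,
    real_inner_self_eq_norm_sq, norm_outwardNormal]
  ring

lemma setIntegral_simplex_radial [Finite ι] {F : Type*} [NormedAddCommGroup F]
    [NormedSpace ℝ F] [CompleteSpace F] {f : V → F} (hf : ContDiff ℝ 1 f) :
    ∫ x in convexHull ℝ (range b), ((Module.finrank ℝ V : ℝ) • f x + fderiv ℝ f x (x - b i))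
      = height b i • ∫ y in facet b i, f y ∂(μHE[Module.finrank ℝ V - 1] : Measure V) := by
  rw [simplex_eq_cone b i]
  exact setIntegral_cone_radial (norm_outwardNormal b i) (height_pos b i) (isCompact_facet b i)
    (fun y hy => inner_outwardNormal_sub_vertex hy) hf

lemma finrank_mul_volume_simplex [Finite ι] :
    Module.finrank ℝ V * volume.real (convexHull ℝ (range b))
      = height b i * (μHE[Module.finrank ℝ V - 1] : Measure V).real (facet b i) := by
  have h := setIntegral_simplex_radial b i (f := fun _ => (1 : ℝ)) contDiff_const
  simpa [mul_comm] using h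

/-- The affine map `G` that agrees with `M` on the facet and vanishes at the opposite vertex is
homogeneous of degree one about that vertex, so `∫ ‖G‖²` over the simplex is a multiple of `∫ ‖M‖²`
over the facet. -/
lemma eqOn_zero_of_integral_norm_sq_facet [Finite ι] {F : Type*} [NormedAddCommGroup F]
    [InnerProductSpace ℝ F] {M : V →ᵃ[ℝ] F}
    (hM : ∫ y in facet b i, ‖M y‖ ^ 2 ∂(μHE[Module.finrank ℝ V - 1] : Measure V) = 0) :
    EqOn M 0 (facet b i) := by
  set G : V →ᵃ[ℝ] F :=
    M - (LinearMap.toSpanSingleton ℝ F (M (b i))).toAffineMap.comp (b.coord i) with hG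
  have hGM : EqOn G M (facet b i) := fun y hy => by simp [hG, coord_eq_zero_of_mem_facet hy]
  have hGlin (x : V) : G.linear (x - b i) = G x := by
    rw [← vsub_eq_sub, G.linearMap_vsub]
    simp [hG]
  have hGc : ContDiff ℝ 1 G := contDiff_affineMap G
  have hderiv (x : V) : fderiv ℝ (fun x => ‖G x‖ ^ 2) x (x - b i) = 2 * ‖G x‖ ^ 2 := by
    rw [((hasFDerivAt_affineMap G x).norm_sq).fderiv]
    simp [hGlin]
  have hradial := setIntegral_simplex_radial b i (hGc.norm_sq ℝ)
  rw [setIntegral_congr_fun (isCompact_facet b i).measurableSet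
      (g := fun y => ‖M y‖ ^ 2) fun y hy => by simp only [hGM hy],
    hM, smul_zero] at hradial
  simp only [hderiv, smul_eq_mul, ← add_mul, integral_const_mul, mul_eq_zero] at hradial
  have hint : ∫ x in convexHull ℝ (range b), ‖G x‖ ^ 2 = 0 :=
    hradial.resolve_left (by positivity)
  have hsimplex := isCompact_simplex b
  have hae : G =ᵐ[volume.restrict (convexHull ℝ (range b))] 0 := by
    rw [setIntegral_eq_zero_iff_of_nonneg_ae (.of_forall fun x => by positivity)
      ((hGc.norm_sq ℝ).continuous.continuousOn.integrableOn_compact hsimplex)] at hint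
    filter_upwards [hint] with x hx
    simpa using hx
  have hzero := Measure.eqOn_of_ae_eq hae hGc.continuous.continuousOn continuousOn_const
    (subset_closure_interior_simplex b)
  exact fun y hy => (hGM hy).symm.trans (hzero (facet_subset b i hy))

/-- Apply the radial formula about each vertex `b i` to `φ` times the `i`-th barycentric component
of `w` and add up. -/
theorem setIntegral_simplex_fderiv_add_trace [Fintype ι] (w : V →ᵃ[ℝ] V) {φ : V → ℝ}
    (hφ : ContDiff ℝ 1 φ) :
    ∫ x in convexHull ℝ (range b), (fderiv ℝ φ x (w x) + φ x * LinearMap.trace ℝ V w.linear)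
      = ∑ i, ∫ y in facet b i, φ y * inner ℝ (outwardNormal b i) (w y)
          ∂(μHE[Module.finrank ℝ V - 1] : Measure V) := by
  set c : ι → V →ᵃ[ℝ] ℝ := fun i => (b.coord i).linear.toAffineMap.comp w with hc
  have hcC (i : ι) : ContDiff ℝ 1 fun x => φ x * c i x := hφ.mul (contDiff_affineMap (c i))
  have hderiv (i : ι) (x v : V) : fderiv ℝ (fun x => φ x * c i x) x v
      = φ x * (b.coord i).linear (w.linear v) + c i x * fderiv ℝ φ x v := by
    rw [fderiv_fun_mul (hφ.differentiable one_ne_zero x)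
      (hasFDerivAt_affineMap (c i) x).differentiableAt,
      (hasFDerivAt_affineMap (c i) x).fderiv]
    simp [hc]
  have hradial (i : ι) : ∫ x in convexHull ℝ (range b),
        -((Module.finrank ℝ V : ℝ) * (φ x * c i x) + fderiv ℝ (fun x => φ x * c i x) x (x - b i))
      = ∫ y in facet b i, φ y * inner ℝ (outwardNormal b i) (w y)
          ∂(μHE[Module.finrank ℝ V - 1] : Measure V) := by
    rw [integral_neg]
    refine (congrArg Neg.neg (setIntegral_simplex_radial b i (hcC i))).trans ?_
    rw [smul_eq_mul, ← integral_const_mul, ← integral_neg]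
    refine integral_congr_ae (.of_forall fun y => ?_)
    simp only [inner_outwardNormal, hc, AffineMap.comp_apply, LinearMap.coe_toAffineMap]
    ring
  simp only [← hradial]
  rw [← integral_finsetSum]
  · congr 1
    ext x
    have hφw : ∑ i, c i x * fderiv ℝ φ x (x - b i) = -fderiv ℝ φ x (w x) := by
      conv_rhs => rw [← sum_coord_linear_smul b (w x) x]
      rw [map_sum, ← Finset.sum_neg_distrib]
      exact Finset.sum_congr rfl fun i _ => by
        rw [map_smul, ← neg_sub (b i), map_neg, smul_eq_mul, mul_neg]; rfl
    have htrace : ∑ i, φ x * (b.coord i).linear (w.linear (x - b i))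
        = -(φ x * LinearMap.trace ℝ V w.linear) := by
      rw [trace_eq_sum_coord_linear b _ x, ← Finset.mul_sum, ← mul_neg, ← Finset.sum_neg_distrib]
      simp only [← map_neg, neg_sub]
    have hsum : ∑ i, c i x = 0 := sum_coord_linear b (w x)
    rw [Finset.sum_neg_distrib, Finset.sum_add_distrib, ← Finset.mul_sum, ← Finset.mul_sum, hsum]
    simp only [hderiv, Finset.sum_add_distrib, hφw, htrace]
    ring
  · intro i _
    have := (hcC i).continuous_fderiv one_ne_zero
    have := (hcC i).continuous
    exact (Continuous.continuousOn (by fun_prop)).integrableOn_compact (isCompact_simplex b)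

end Simplex

/-! ### Faces of the mesh -/

namespace Mesh

variable {d : ℕ} {Ω : Set (E d)} {T : Mesh d Ω}

lemma mem_faces {e : Finset (E d)} : e ∈ T.faces ↔ ∃ K ∈ T.elems, e ⊆ K ∧ e.card = d := by
  simp [faces, Finset.mem_powersetCard]

lemma card_face (e : T.faces) : e.1.card = d := by
  obtain ⟨K, -, -, h⟩ := mem_faces.1 e.2
  exact h

lemma card_elem (K : T.elems) : K.1.card = d + 1 := T.card_eq K.1 K.2

/-- The vertices of an element as an affine basis. -/
noncomputable def elemBasis (K : T.elems) : AffineBasis K.1 ℝ (E d) where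
  toFun := Subtype.val
  ind' := T.indep K.1 K.2
  tot' := (T.indep K.1 K.2).affineSpan_eq_top_iff_card_eq_finrank_add_one.2 (by
    rw [Fintype.card_coe, card_elem, finrank_euclideanSpace_fin])

lemma range_elemBasis (K : T.elems) : range (elemBasis K) = K.1 := Subtype.range_coe

lemma interior_hull_nonempty (K : T.elems) :
    (interior (convexHull ℝ (K.1 : Set (E d)))).Nonempty :=
  range_elemBasis K ▸ interior_simplex_nonempty (elemBasis K)

instance [NeZero d] (K : T.elems) : Nontrivial K.1 := by
  refine Fintype.one_lt_card_iff_nontrivial.1 ?_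
  rw [Fintype.card_coe, card_elem]
  exact Nat.succ_lt_succ (Nat.pos_of_neZero d)

open Classical in
/-- The face of `K` opposite to the vertex `a`. -/
noncomputable def faceOf (K : T.elems) (a : K.1) : T.faces :=
  ⟨K.1.erase a, mem_faces.2 ⟨K.1, K.2, Finset.erase_subset _ _, by
    rw [Finset.card_erase_of_mem a.2, card_elem, Nat.add_sub_cancel]⟩⟩

lemma mem_faceOf {K : T.elems} {a : K.1} {x : E d} :
    x ∈ (faceOf K a).1 ↔ x ≠ a ∧ x ∈ K.1 := by
  classical exact Finset.mem_erase

lemma faceOf_subset (K : T.elems) (a : K.1) : (faceOf K a).1 ⊆ K.1 :=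
  fun _ hx => (mem_faceOf.1 hx).2

lemma faceOf_injective (K : T.elems) : Function.Injective (faceOf K) := fun a a' h => by
  by_contra ha
  exact (mem_faceOf.1 (h ▸ mem_faceOf.2 ⟨fun h' => ha (Subtype.ext h'), a.2⟩)).1 rfl

lemma exists_eq_faceOf {K : T.elems} {e : T.faces} (h : e.1 ⊆ K.1) : ∃ a, e = faceOf K a := by
  classical
  obtain ⟨a, ha, hins⟩ : ∃ a, a ∉ e.1 ∧ insert a e.1 = K.1 :=
    Finset.covBy_iff_exists_insert.1 (Finset.covBy_iff_card_sdiff_eq_one.2 ⟨h, by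
      rw [Finset.card_sdiff_of_subset h, card_elem, card_face, Nat.add_sub_cancel_left]⟩)
  refine ⟨⟨a, hins ▸ Finset.mem_insert_self a _⟩, Subtype.ext ?_⟩
  simp only [faceOf, ← hins, Finset.erase_insert ha]

lemma exists_elem_eq_faceOf (e : T.faces) : ∃ K a, e = faceOf K a := by
  obtain ⟨K, hK, he, -⟩ := mem_faces.1 e.2
  exact ⟨⟨K, hK⟩, exists_eq_faceOf (K := ⟨K, hK⟩) he⟩

open Classical in
lemma sum_faces_of_elem {M : Type*} [AddCommMonoid M] (K : T.elems) (Ψ : T.faces → M) :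
    ∑ e : T.faces with e.1 ⊆ K.1, Ψ e = ∑ a, Ψ (faceOf K a) := by
  refine (Finset.sum_bij (fun a _ => faceOf K a) (fun a _ => ?_)
    (fun a _ a' _ h => faceOf_injective K h) (fun e he => ?_) fun _ _ => rfl).symm
  · simpa using faceOf_subset K a
  · obtain ⟨a, rfl⟩ := exists_eq_faceOf (Finset.mem_filter.1 he).2
    exact ⟨a, Finset.mem_univ _, rfl⟩

open Classical in
lemma card_faces_of_elem (K : T.elems) :
    (Finset.univ.filter fun e : T.faces => e.1 ⊆ K.1).card = d + 1 := by
  rw [Finset.card_eq_sum_ones, sum_faces_of_elem K, ← Finset.card_eq_sum_ones, Finset.card_univ,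
    Fintype.card_coe, card_elem]

lemma facet_elemBasis (K : T.elems) (a : K.1) :
    facet (elemBasis K) a = convexHull ℝ ((faceOf K a).1 : Set (E d)) := by
  rw [facet]
  congr 1
  ext x
  simp only [mem_image, mem_compl_iff, mem_singleton_iff, Finset.mem_coe, mem_faceOf]
  exact ⟨by rintro ⟨y, hy, rfl⟩; exact ⟨fun h => hy (Subtype.ext h), y.2⟩,
    fun ⟨hxa, hx⟩ => ⟨⟨x, hx⟩, fun h => hxa (congrArg Subtype.val h), rfl⟩⟩

lemma hull_inter_subset {K L : T.elems} (hKL : K ≠ L) {e : T.faces} (heK : e.1 ⊆ K.1)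
    (heL : e.1 ⊆ L.1) :
    convexHull ℝ (K.1 : Set (E d)) ∩ convexHull ℝ (L.1 : Set (E d))
      ⊆ convexHull ℝ (e.1 : Set (E d)) := by
  classical
  rw [T.inter_eq K.1 K.2 L.1 L.2, ← Finset.coe_inter]
  refine convexHull_mono (Finset.coe_subset.2 ?_)
  have hcard : (K.1 ∩ L.1).card ≤ d := by
    by_contra! h
    have hK : K.1 ∩ L.1 = K.1 := Finset.eq_of_subset_of_card_le Finset.inter_subset_left
      (by rwa [card_elem])
    have hL : K.1 ∩ L.1 = L.1 := Finset.eq_of_subset_of_card_le Finset.inter_subset_right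
      (by rwa [card_elem])
    exact hKL (Subtype.ext (hK.symm.trans hL))
  exact (Finset.eq_of_subset_of_card_le (Finset.subset_inter heK heL) (by rwa [card_face])).ge

namespace Orientation

variable (O : T.Orientation)

open Classical in
/-- The unit normal of the face `e` of `K` that points out of `K`. -/
noncomputable def outNormal (K : T.elems) (e : T.faces) : E d :=
  if K = O.plus e then O.normal e else -O.normal e

lemma outNormal_plus (e : T.faces) : O.outNormal (O.plus e) e = O.normal e := if_pos rfl

lemma outNormal_minus {e : T.faces} (he : T.IsInterior e) :
    O.outNormal (O.minus e) e = -O.normal e :=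
  if_neg (O.plus_ne_minus e he).symm

lemma eq_plus {K : T.elems} {e : T.faces} (he : ¬ T.IsInterior e) (h : e.1 ⊆ K.1) :
    K = O.plus e := by
  by_contra hne
  exact he ⟨K, O.plus e, hne, h, O.subset_plus e⟩

end Orientation

section Normals

variable [NeZero d]

lemma outwardNormal_eq_neg {K L : T.elems} (hKL : K ≠ L) {a : K.1} {c : L.1}
    (h : faceOf K a = faceOf L c) :
    outwardNormal (elemBasis L) c = -outwardNormal (elemBasis K) a := by
  refine outwardNormal_eq_neg_of_inter_subset_facet ?_ ?_
  · rw [facet_elemBasis, facet_elemBasis, h]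
  · rw [range_elemBasis, range_elemBasis, facet_elemBasis]
    exact hull_inter_subset hKL (faceOf_subset K a) (h ▸ faceOf_subset L c)

lemma IsOutwardNormal.eq_outwardNormal {K : T.elems} {a : K.1} {N : E d}
    (h : IsOutwardNormal K.1 (faceOf K a).1 N) : N = outwardNormal (elemBasis K) a := by
  have hmem {j : K.1} (hj : j ≠ a) : (j : E d) ∈ (faceOf K a).1 :=
    mem_faceOf.2 ⟨fun h' => hj (Subtype.ext h'), j.2⟩
  exact StokesEG.eq_outwardNormal h.1 (fun j hj k hk => h.2.1 j (hmem hj) k (hmem hk))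
    fun j hj => h.2.2 j (hmem hj) a a.2 fun h' => (mem_faceOf.1 h').1 rfl

namespace Orientation

variable (O : T.Orientation)

lemma outNormal_faceOf (K : T.elems) (a : K.1) :
    O.outNormal K (faceOf K a) = outwardNormal (elemBasis K) a := by
  obtain ⟨c, hc⟩ := exists_eq_faceOf (O.subset_plus (faceOf K a))
  have hnormal : O.normal (faceOf K a) = outwardNormal (elemBasis (O.plus (faceOf K a))) c :=
    IsOutwardNormal.eq_outwardNormal (hc ▸ O.outward (faceOf K a))
  by_cases hK : K = O.plus (faceOf K a)
  · rw [outNormal, if_pos hK]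
    exact IsOutwardNormal.eq_outwardNormal (by simpa only [← hK] using O.outward (faceOf K a))
  · rw [outNormal, if_neg hK, hnormal, outwardNormal_eq_neg hK hc, neg_neg]

/-- Otherwise three outward normals of the same face would be pairwise opposite. -/
lemma eq_plus_or_minus {K : T.elems} {e : T.faces} (he : T.IsInterior e) (h : e.1 ⊆ K.1) :
    K = O.plus e ∨ K = O.minus e := by
  by_contra! hne
  obtain ⟨a, ha⟩ := exists_eq_faceOf (O.subset_plus e)
  obtain ⟨a', ha'⟩ := exists_eq_faceOf (O.subset_minus e)
  obtain ⟨c, hc⟩ := exists_eq_faceOf h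
  have hpm := outwardNormal_eq_neg (O.plus_ne_minus e he) (ha.symm.trans ha')
  rw [← neg_neg (outwardNormal (elemBasis (O.plus e)) a),
    ← outwardNormal_eq_neg hne.1.symm (ha.symm.trans hc),
    outwardNormal_eq_neg hne.2.symm (ha'.symm.trans hc), neg_neg] at hpm
  have hinner := congrArg (inner ℝ (outwardNormal (elemBasis (O.minus e)) a')) hpm
  rw [inner_neg_right, real_inner_self_eq_norm_sq, norm_outwardNormal] at hinner
  norm_num at hinner

open Classical in
lemma sum_elems_sum_faces {M : Type*} [AddCommMonoid M] (Ψ : T.elems → T.faces → M) :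
    ∑ K : T.elems, ∑ e : T.faces with e.1 ⊆ K.1, Ψ K e
      = ∑ e : T.faces, (Ψ (O.plus e) e + if T.IsInterior e then Ψ (O.minus e) e else 0) := by
  simp only [Finset.sum_filter]
  rw [Finset.sum_comm]
  refine Finset.sum_congr rfl fun e _ => ?_
  rw [← Finset.sum_filter]
  by_cases he : T.IsInterior e
  · have hpair : (Finset.univ.filter fun K : T.elems => e.1 ⊆ K.1) = {O.plus e, O.minus e} := by
      ext K
      simp only [Finset.mem_filter, Finset.mem_univ, true_and, Finset.mem_insert,
        Finset.mem_singleton]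
      exact ⟨O.eq_plus_or_minus he,
        by rintro (rfl | rfl); exacts [O.subset_plus e, O.subset_minus e]⟩
    rw [hpair, Finset.sum_pair (O.plus_ne_minus e he), if_pos he]
  · have hsingle : (Finset.univ.filter fun K : T.elems => e.1 ⊆ K.1) = {O.plus e} := by
      ext K
      simp only [Finset.mem_filter, Finset.mem_univ, true_and, Finset.mem_singleton]
      exact ⟨O.eq_plus he, by rintro rfl; exact O.subset_plus e⟩
    rw [hsingle, Finset.sum_singleton, if_neg he, add_zero]

end Orientation

end Normals

section FaceIntegral

lemma isCompact_hull (s : Finset (E d)) : IsCompact (convexHull ℝ (s : Set (E d))) :=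
  s.finite_toSet.isCompact_convexHull ℝ

lemma faceIntegral_const_mul (e : T.faces) (c : ℝ) (f : E d → ℝ) :
    T.faceIntegral e (fun x => c * f x) = c * T.faceIntegral e f :=
  integral_const_mul _ _

lemma faceIntegral_congr {e : T.faces} {f g : E d → ℝ}
    (h : EqOn f g (convexHull ℝ (e.1 : Set (E d)))) : T.faceIntegral e f = T.faceIntegral e g :=
  setIntegral_congr_fun (isCompact_hull e.1).measurableSet h

lemma faceIntegral_faceOf (K : T.elems) (a : K.1) (f : E d → ℝ) :
    T.faceIntegral (faceOf K a) f
      = ∫ x in facet (elemBasis K) a, f x ∂(μHE[Module.finrank ℝ (E d) - 1] : Measure (E d)) := by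
  rw [faceIntegral, facet_elemBasis, finrank_euclideanSpace_fin]

/-- The length or area of a face. -/
noncomputable def faceArea (T : Mesh d Ω) (e : T.faces) : ℝ :=
  (μHE[d - 1] : Measure (E d)).real (convexHull ℝ (e.1 : Set (E d)))

/-- The area or volume of an element. -/
noncomputable def elemVol (T : Mesh d Ω) (K : T.elems) : ℝ :=
  volume.real (convexHull ℝ (K.1 : Set (E d)))

lemma faceIntegral_const (e : T.faces) (c : ℝ) :
    T.faceIntegral e (fun _ => c) = T.faceArea e * c :=
  setIntegral_const c

lemma elemIntegral_const (K : T.elems) (c : ℝ) :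
    T.elemIntegral K (fun _ => c) = T.elemVol K * c :=
  setIntegral_const c

lemma elemVol_pos (K : T.elems) : 0 < T.elemVol K :=
  ENNReal.toReal_pos
    (Measure.measure_pos_of_nonempty_interior volume (interior_hull_nonempty K)).ne'
    (isCompact_hull K.1).measure_lt_top.ne

variable [NeZero d]

lemma faceMeasure_lt_top (e : T.faces) :
    (μHE[d - 1] : Measure (E d)) (convexHull ℝ (e.1 : Set (E d))) < ⊤ := by
  obtain ⟨K, a, rfl⟩ := exists_elem_eq_faceOf e
  have h := euclideanHausdorffMeasure_facet_lt_top (elemBasis K) a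
  rwa [facet_elemBasis, finrank_euclideanSpace_fin] at h

lemma integrableOn_face (e : T.faces) {F : Type*} [NormedAddCommGroup F]
    [SecondCountableTopologyEither (E d) F] {g : E d → F} (hg : Continuous g) :
    IntegrableOn g (convexHull ℝ (e.1 : Set (E d))) (μHE[d - 1] : Measure (E d)) := by
  obtain ⟨C, hC⟩ := (isCompact_hull e.1).exists_bound_of_continuousOn hg.continuousOn
  exact Measure.integrableOn_of_bounded (faceMeasure_lt_top e).ne hg.aestronglyMeasurable
    (ae_restrict_of_forall_mem (isCompact_hull e.1).measurableSet hC)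

lemma faceIntegral_add (e : T.faces) {f g : E d → ℝ} (hf : Continuous f) (hg : Continuous g) :
    T.faceIntegral e (fun x => f x + g x) = T.faceIntegral e f + T.faceIntegral e g :=
  integral_add (integrableOn_face e hf) (integrableOn_face e hg)

lemma dim_mul_elemVol (K : T.elems) (a : K.1) :
    d * T.elemVol K = height (elemBasis K) a * T.faceArea (faceOf K a) := by
  have h := finrank_mul_volume_simplex (elemBasis K) a
  rwa [range_elemBasis, facet_elemBasis, finrank_euclideanSpace_fin] at h

lemma faceArea_pos (e : T.faces) : 0 < T.faceArea e := by
  obtain ⟨K, a, rfl⟩ := exists_elem_eq_faceOf e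
  refine pos_of_mul_pos_right ?_ (height_pos (elemBasis K) a).le
  rw [← dim_mul_elemVol]
  exact mul_pos (Nat.cast_pos.2 (Nat.pos_of_neZero d)) (elemVol_pos K)

end FaceIntegral

lemma continuous_jump (O : T.Orientation) (w : T.VecP1) (e : T.faces) :
    Continuous fun x => O.jump e fun K => w K x := by
  unfold Orientation.jump
  have := fun K => (w K).continuous_of_finiteDimensional
  split_ifs <;> fun_prop

variable [NeZero d]

open Classical in
lemma elemIntegral_fderiv_add_divergence (O : T.Orientation) (K : T.elems) (w : E d →ᵃ[ℝ] E d)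
    {φ : E d → ℝ} (hφ : ContDiff ℝ 1 φ) :
    T.elemIntegral K (fun x => fderiv ℝ φ x (w x) + φ x * divergence w)
      = ∑ e : T.faces with e.1 ⊆ K.1,
          T.faceIntegral e fun x => φ x * inner ℝ (w x) (O.outNormal K e) := by
  rw [sum_faces_of_elem, elemIntegral, ← range_elemBasis]
  simp only [O.outNormal_faceOf, faceIntegral_faceOf, real_inner_comm (outwardNormal _ _)]
  exact setIntegral_simplex_fderiv_add_trace (elemBasis K) w hφ

theorem sum_elemIntegral_fderiv_add_divergence (O : T.Orientation) (w : T.VecP1) {φ : E d → ℝ}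
    (hφ : ContDiff ℝ 1 φ) :
    ∑ K : T.elems, T.elemIntegral K (fun x => fderiv ℝ φ x (w K x) + φ x * divergence (w K))
      = ∑ e : T.faces, T.faceIntegral e fun x =>
          φ x * inner ℝ (O.jump e fun K => w K x) (O.normal e) := by
  classical
  simp only [elemIntegral_fderiv_add_divergence O _ _ hφ, O.sum_elems_sum_faces, O.outNormal_plus]
  refine Finset.sum_congr rfl fun e _ => ?_
  have := hφ.continuous
  have := fun K => (w K).continuous_of_finiteDimensional
  unfold Orientation.jump
  split_ifs with he
  · rw [O.outNormal_minus he, ← faceIntegral_add e (by fun_prop) (by fun_prop)]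
    simp only [inner_neg_right, inner_sub_left, mul_neg, mul_sub, ← sub_eq_add_neg]
  · rw [add_zero]

end Mesh

/-! ### Connectivity of the mesh through faces -/

section GeneralPosition

variable {V : Type*} [NormedAddCommGroup V] [NormedSpace ℝ V]

lemma affineSpan_ne_top_of_card_le {s : Finset V} (hs : s.card ≤ Module.finrank ℝ V) :
    affineSpan ℝ (s : Set V) ≠ ⊤ := by
  classical
  intro h
  rcases s.eq_empty_or_nonempty with rfl | hne
  · simp at h
  · have hle := finrank_vectorSpan_image_finset_le ℝ (id : V → V) s (n := s.card - 1)
      (Nat.sub_add_cancel hne.card_pos).symm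
    rw [Finset.image_id, ← direction_affineSpan, h, AffineSubspace.direction_top,
      finrank_top] at hle
    have := hne.card_pos
    omega

variable [FiniteDimensional ℝ V] {ι : Type*} [Finite ι]

lemma exists_mem_forall_notMem_affineSubspace {U : Set V} (hU : IsOpen U) (hne : U.Nonempty)
    {M : ι → AffineSubspace ℝ V} (hM : ∀ i, M i ≠ ⊤) : ∃ x ∈ U, ∀ i, x ∉ M i := by
  borelize V
  by_contra! hcover
  have hsub : U ⊆ ⋃ i, (M i : Set V) := fun x hx => mem_iUnion.2 (hcover x hx)
  have hnull : Measure.addHaar (⋃ i, (M i : Set V)) = 0 :=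
    measure_iUnion_null fun i => Measure.addHaar_affineSubspace _ _ (hM i)
  exact (hU.measure_pos Measure.addHaar hne).ne' (measure_mono_null hsub hnull)

lemma exists_segment_disjoint_affineSpan {U W : Set V} (hU : IsOpen U) (hUne : U.Nonempty)
    (hW : IsOpen W) (hWne : W.Nonempty) {s : ι → Finset V}
    (hs : ∀ i, (s i).card < Module.finrank ℝ V) :
    ∃ x ∈ U, ∃ y ∈ W, ∀ i, Disjoint (segment ℝ x y) (affineSpan ℝ (s i : Set V)) := by
  classical
  obtain ⟨x, hxU, hx⟩ := exists_mem_forall_notMem_affineSubspace hU hUne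
    (M := fun i => affineSpan ℝ (s i : Set V)) fun i => affineSpan_ne_top_of_card_le (hs i).le
  obtain ⟨y, hyW, hy⟩ := exists_mem_forall_notMem_affineSubspace hW hWne
    (M := fun i => affineSpan ℝ ((insert x (s i) : Finset V) : Set V))
    fun i => affineSpan_ne_top_of_card_le ((Finset.card_insert_le _ _).trans (hs i))
  refine ⟨x, hxU, y, hyW, fun i => disjoint_left.2 fun z hz hzs => hy i ?_⟩
  rw [segment_eq_image_lineMap] at hz
  obtain ⟨t, -, rfl⟩ := hz
  have ht : t ≠ 0 := by
    rintro rfl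
    exact hx i (by simpa using hzs)
  have hle : affineSpan ℝ (s i : Set V) ≤ affineSpan ℝ ((insert x (s i) : Finset V) : Set V) :=
    affineSpan_mono ℝ (Finset.coe_subset.2 (Finset.subset_insert _ _))
  have hmem := AffineMap.lineMap_mem t⁻¹
    (subset_affineSpan ℝ _ (Finset.mem_coe.2 (Finset.mem_insert_self x (s i)))) (hle hzs)
  rwa [AffineMap.lineMap_lineMap_right, inv_mul_cancel₀ ht, AffineMap.lineMap_apply_one] at hmem

end GeneralPosition

namespace Mesh

variable {d : ℕ} {Ω : Set (E d)} {T : Mesh d Ω}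

lemma hull_subset_closure (K : T.elems) : convexHull ℝ (K.1 : Set (E d)) ⊆ closure Ω := by
  rw [← T.union_eq]
  exact subset_biUnion_of_mem (u := fun K : Finset (E d) => convexHull ℝ (K : Set (E d))) K.2

lemma hull_subset_closure_interior (K : T.elems) :
    convexHull ℝ (K.1 : Set (E d)) ⊆ closure (interior (convexHull ℝ (K.1 : Set (E d)))) :=
  range_elemBasis K ▸ subset_closure_interior_simplex (elemBasis K)

lemma interior_hull_subset (hΩ : interior (closure Ω) = Ω) (K : T.elems) :
    interior (convexHull ℝ (K.1 : Set (E d))) ⊆ Ω :=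
  (interior_mono (hull_subset_closure K)).trans hΩ.le

lemma exists_mem_hull {x : E d} (hx : x ∈ closure Ω) :
    ∃ K : T.elems, x ∈ convexHull ℝ (K.1 : Set (E d)) := by
  rw [← T.union_eq, mem_iUnion₂] at hx
  obtain ⟨K, hK, hxK⟩ := hx
  exact ⟨⟨K, hK⟩, hxK⟩

lemma exists_mem_hull_of_isPreconnected {S : Set (E d)} (hS : IsPreconnected S)
    (hSΩ : S ⊆ closure Ω) {P : T.elems → Prop} {K L : T.elems} (hK : P K) (hL : ¬ P L)
    (hSK : (S ∩ convexHull ℝ (K.1 : Set (E d))).Nonempty)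
    (hSL : (S ∩ convexHull ℝ (L.1 : Set (E d))).Nonempty) :
    ∃ z ∈ S, ∃ K' L' : T.elems, P K' ∧ ¬ P L' ∧ z ∈ convexHull ℝ (K'.1 : Set (E d)) ∧
      z ∈ convexHull ℝ (L'.1 : Set (E d)) := by
  let region (Q : T.elems → Prop) : Set (E d) :=
    ⋃ K : {K : T.elems // Q K}, convexHull ℝ (K.1.1 : Set (E d))
  have hclosed (Q : T.elems → Prop) : IsClosed (region Q) :=
    isClosed_iUnion_of_finite fun K => (isCompact_hull _).isClosed
  have hmem {Q : T.elems → Prop} {K : T.elems} (hQ : Q K) :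
      convexHull ℝ (K.1 : Set (E d)) ⊆ region Q :=
    subset_iUnion_of_subset ⟨K, hQ⟩ Subset.rfl
  have hcover : S ⊆ region P ∪ region fun K => ¬ P K := fun x hx => by
    obtain ⟨K', hxK'⟩ := exists_mem_hull (T := T) (hSΩ hx)
    by_cases hP : P K'
    · exact Or.inl (hmem hP hxK')
    · exact Or.inr (hmem (Q := fun K => ¬ P K) hP hxK')
  obtain ⟨z, hz, hzP, hzP'⟩ := isPreconnected_closed_iff.1 hS _ _ (hclosed P)
    (hclosed fun K => ¬ P K) hcover (hSK.mono (inter_subset_inter_right S (hmem hK)))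
    (hSL.mono (inter_subset_inter_right S (hmem (Q := fun K => ¬ P K) hL)))
  obtain ⟨⟨K', hK'⟩, hzK'⟩ := mem_iUnion.1 hzP
  obtain ⟨⟨L', hL'⟩, hzL'⟩ := mem_iUnion.1 hzP'
  exact ⟨z, hz, K', L', hK', hL', hzK', hzL'⟩

/-- Elements on which `g` differs share at most `d - 1` vertices, so the intersections of such
elements lie in affine subspaces of codimension at least two, which a generic segment avoids. -/
theorem eq_of_eq_of_common_face (hΩ : interior (closure Ω) = Ω) (hconn : IsPreconnected Ω)
    {X : Type*} {g : T.elems → X}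
    (hg : ∀ (e : T.faces) (K L : T.elems), e.1 ⊆ K.1 → e.1 ⊆ L.1 → g K = g L) (K₀ L₀ : T.elems) :
    g K₀ = g L₀ := by
  classical
  by_contra! hne
  have hmeetΩ (K : T.elems) : (Ω ∩ convexHull ℝ (K.1 : Set (E d))).Nonempty :=
    (interior_hull_nonempty K).mono
      (subset_inter (interior_hull_subset hΩ K) interior_subset)
  obtain ⟨z, hzΩ, K, L, hK, hL, hzK, hzL⟩ := exists_mem_hull_of_isPreconnected hconn
    subset_closure (P := fun K => g K = g K₀) rfl hne.symm (hmeetΩ K₀) (hmeetΩ L₀)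
  obtain ⟨r, hr, hball⟩ := Metric.isOpen_iff.1 (hΩ ▸ isOpen_interior : IsOpen Ω) z hzΩ
  have hmeetBall (J : T.elems) (hJ : z ∈ convexHull ℝ (J.1 : Set (E d))) :
      (Metric.ball z r ∩ interior (convexHull ℝ (J.1 : Set (E d)))).Nonempty :=
    mem_closure_iff.1 (hull_subset_closure_interior J hJ) _ Metric.isOpen_ball
      (Metric.mem_ball_self hr)
  have hcard (p : {p : T.elems × T.elems // g p.1 ≠ g p.2}) :
      (p.1.1.1 ∩ p.1.2.1).card < Module.finrank ℝ (E d) := by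
    rw [finrank_euclideanSpace_fin]
    by_contra! h
    obtain ⟨e, he, hce⟩ := Finset.exists_subset_card_eq h
    have heK := he.trans Finset.inter_subset_left
    exact p.2 (hg ⟨e, mem_faces.2 ⟨p.1.1.1, p.1.1.2, heK, hce⟩⟩ _ _ heK
      (he.trans Finset.inter_subset_right))
  obtain ⟨x, ⟨hxball, hxK⟩, y, ⟨hyball, hyL⟩, hdisj⟩ := exists_segment_disjoint_affineSpan
    (Metric.isOpen_ball.inter isOpen_interior) (hmeetBall K hzK)
    (Metric.isOpen_ball.inter isOpen_interior) (hmeetBall L hzL) hcard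
  have hseg : segment ℝ x y ⊆ closure Ω :=
    ((convex_ball z r).segment_subset hxball hyball).trans (hball.trans subset_closure)
  obtain ⟨w, hw, K', L', hK', hL', hwK', hwL'⟩ := exists_mem_hull_of_isPreconnected
    (convex_segment x y).isPreconnected hseg (P := fun K => g K = g K₀) hK hL
    ⟨x, left_mem_segment ℝ x y, interior_subset hxK⟩
    ⟨y, right_mem_segment ℝ x y, interior_subset hyL⟩
  refine disjoint_left.1 (hdisj ⟨(K', L'), fun h => hL' (h.symm.trans hK')⟩) hw
    (convexHull_subset_affineSpan _ ?_)
  rw [Finset.coe_inter, ← T.inter_eq K'.1 K'.2 L'.1 L'.2]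
  exact ⟨hwK', hwL'⟩

lemma elems_nonempty (hne : Ω.Nonempty) : Nonempty T.elems := by
  obtain ⟨x, hx⟩ := hne
  exact ⟨(exists_mem_hull (T := T) (subset_closure hx)).choose⟩

/-- If all faces were interior, the identity field would have no jumps, although its divergence
`d` is positive. -/
lemma exists_not_isInterior [NeZero d] (O : T.Orientation) (hne : Ω.Nonempty) :
    ∃ e : T.faces, ¬ T.IsInterior e := by
  by_contra! hint
  have hparts := sum_elemIntegral_fderiv_add_divergence O (fun _ => AffineMap.id ℝ (E d))
    (φ := fun _ => 1) contDiff_const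
  have hdiv : divergence (AffineMap.id ℝ (E d)) = d := by
    simp [divergence, LinearMap.trace_id]
  simp only [fderiv_fun_const, Pi.zero_apply, zero_apply, zero_add, one_mul,
    hdiv, elemIntegral_const, Orientation.jump, hint, if_true, sub_self, inner_zero_left,
    faceIntegral_const, mul_zero, Finset.sum_const_zero] at hparts
  have := elems_nonempty (T := T) hne
  refine (Finset.sum_pos (fun K _ => ?_) Finset.univ_nonempty).ne' hparts
  exact mul_pos (elemVol_pos K) (Nat.cast_pos.2 (Nat.pos_of_neZero d))

end Mesh

/-! ### The velocity reconstruction -/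

section PrescribedValues

lemma exists_affineMap_apply_vertex {ι V W : Type*} [Finite ι] [AddCommGroup V] [Module ℝ V]
    [AddCommGroup W] [Module ℝ W] (b : AffineBasis ι ℝ V) (u : ι → W) :
    ∃ w : V →ᵃ[ℝ] W, ∀ i, w (b i) = u i := by
  classical
  have := Fintype.ofFinite ι
  refine ⟨(Fintype.linearCombination ℝ u).toAffineMap.comp b.coords, fun i => ?_⟩
  simp [Fintype.linearCombination_apply, AffineBasis.coord_apply]

variable {ι V : Type*} [Finite ι] [Nontrivial ι] [NormedAddCommGroup V] [InnerProductSpace ℝ V]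
  [FiniteDimensional ℝ V] (b : AffineBasis ι ℝ V)

lemma eq_zero_of_inner_outwardNormal_eq_zero {w : V →ᵃ[ℝ] V}
    (h : ∀ i, ∀ y ∈ facet b i, inner ℝ (outwardNormal b i) (w y) = 0) : w = 0 := by
  have := Fintype.ofFinite ι
  refine AffineMap.ext_on b.tot ?_
  rintro _ ⟨j, rfl⟩
  rw [← sum_coord_linear_smul b (w (b j)) (b j)]
  refine Finset.sum_eq_zero fun i _ => ?_
  obtain rfl | hji := eq_or_ne j i
  · rw [sub_self, smul_zero]
  · have hj := h i (b j) (subset_convexHull ℝ _ ⟨j, hji, rfl⟩)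
    rw [inner_outwardNormal, neg_eq_zero, mul_eq_zero] at hj
    rw [hj.resolve_left (height_pos b i).ne', zero_smul]

/-- At a vertex `b j` the edge vector `b i - b j` is orthogonal to all normals of facets through
`b j` but the `i`-th, so the normal components there can be prescribed independently. -/
lemma exists_affineMap_inner_outwardNormal (τ : ι → V →ᵃ[ℝ] ℝ) :
    ∃ w : V →ᵃ[ℝ] V, ∀ i,
      EqOn (fun x => inner ℝ (outwardNormal b i) (w x)) (τ i) (facet b i) := by
  classical
  have := Fintype.ofFinite ι
  obtain ⟨w, hw⟩ := exists_affineMap_apply_vertex b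
    fun j => ∑ k, -(τ k (b j) / height b k) • (b k - b j)
  refine ⟨w, fun i => eqOn_convexHull_affineMap
    (f := (innerₛₗ ℝ (outwardNormal b i)).toAffineMap.comp w) ?_⟩
  rintro _ ⟨j, hj : j ≠ i, rfl⟩
  change inner ℝ (outwardNormal b i) (w (b j)) = τ i (b j)
  rw [hw, inner_outwardNormal, map_sum, Finset.sum_eq_single i]
  · rw [map_smul, coord_linear_sub, b.coord_apply_eq, b.coord_apply_ne hj.symm, sub_zero,
      smul_eq_mul, mul_one, mul_neg, neg_neg, mul_div_cancel₀ _ (height_pos b i).ne']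
  · intro k _ hk
    rw [map_smul, coord_linear_sub, b.coord_apply_ne hk.symm, b.coord_apply_ne hj.symm, sub_zero,
      smul_zero]
  · simp

end PrescribedValues

namespace Mesh

variable {d : ℕ} {Ω : Set (E d)} {T : Mesh d Ω}

section GluedFunctions

lemma integrableOn_elem (K : T.elems) {F : Type*} [NormedAddCommGroup F] {f : E d → F}
    (hf : Continuous f) : IntegrableOn f (convexHull ℝ (K.1 : Set (E d))) :=
  hf.continuousOn.integrableOn_compact (isCompact_hull K.1)

lemma elemIntegral_add (K : T.elems) {f g : E d → ℝ} (hf : Continuous f) (hg : Continuous g) :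
    T.elemIntegral K (fun x => f x + g x) = T.elemIntegral K f + T.elemIntegral K g :=
  integral_add (integrableOn_elem K hf) (integrableOn_elem K hg)

lemma map_glue {F G : Type*} [AddCommGroup F] [AddCommGroup G] (f : T.elems → E d → F)
    (ℓ : E d → F →+ G) (x : E d) :
    ℓ x (T.glue f x) = T.glue (fun K y => ℓ y (f K y)) x := by
  classical
  unfold glue
  rw [map_sum]
  refine Finset.sum_congr rfl fun K _ => ?_
  by_cases hx : x ∈ interior (convexHull ℝ (K.1 : Set (E d)))
  · rw [indicator_of_mem hx, indicator_of_mem hx]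
  · rw [indicator_of_notMem hx, indicator_of_notMem hx, map_zero]

lemma setIntegral_glue (hΩ : interior (closure Ω) = Ω) {f : T.elems → E d → ℝ}
    (hf : ∀ K, Continuous (f K)) :
    ∫ x in Ω, T.glue f x = ∑ K : T.elems, T.elemIntegral K (f K) := by
  unfold glue elemIntegral
  rw [integral_finsetSum]
  · refine Finset.sum_congr rfl fun K _ => ?_
    rw [integral_indicator isOpen_interior.measurableSet,
      Measure.restrict_restrict isOpen_interior.measurableSet,
      inter_eq_left.2 (interior_hull_subset hΩ K)]
    exact setIntegral_congr_set (interior_ae_eq_of_null_frontier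
      ((convex_convexHull ℝ _).addHaar_frontier _))
  · intro K _
    exact (((integrableOn_elem K (hf K)).mono_set interior_subset).integrable_indicator
      isOpen_interior.measurableSet).restrict

lemma memLp_glue {F : Type*} [NormedAddCommGroup F] [SecondCountableTopologyEither (E d) F]
    {f : T.elems → E d → F} (hf : ∀ K, Continuous (f K)) :
    MemLp (T.glue f) 2 (volume.restrict Ω) := by
  unfold glue
  refine memLp_finsetSum _ fun K _ => MemLp.restrict _ ?_
  rw [memLp_indicator_iff_restrict isOpen_interior.measurableSet]
  refine MemLp.mono_measure (Measure.restrict_mono_set _ interior_subset) ?_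
  have hK := isCompact_hull K.1
  obtain ⟨C, hC⟩ := hK.exists_bound_of_continuousOn (hf K).continuousOn
  have : IsFiniteMeasure (volume.restrict (convexHull ℝ (K.1 : Set (E d)))) :=
    ⟨by simpa only [Measure.restrict_apply_univ] using hK.measure_lt_top⟩
  exact MemLp.of_bound (hf K).aestronglyMeasurable C
    (ae_restrict_of_forall_mem hK.measurableSet hC)

end GluedFunctions

namespace Orientation

variable (O : T.Orientation)

lemma avg_apply (e : T.faces) (v : T.VecP1) (x : E d) :
    O.avg e v x = O.avg e fun K => v K x := by
  unfold avg
  split_ifs <;> rfl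

/-- The affine function that the normal component on `e` of the reconstruction of `v` equals. -/
noncomputable def reconTrace (v : T.VecP1) (e : T.faces) : E d →ᵃ[ℝ] ℝ :=
  open Classical in
  if T.IsInterior e then (innerₛₗ ℝ (O.normal e)).toAffineMap.comp (O.avg e v) else 0

lemma reconTrace_of_isInterior (v : T.VecP1) {e : T.faces} (he : T.IsInterior e) (x : E d) :
    O.reconTrace v e x = inner ℝ (O.avg e fun K => v K x) (O.normal e) := by
  rw [reconTrace, if_pos he, ← avg_apply, real_inner_comm]
  rfl

lemma reconTrace_of_not_isInterior (v : T.VecP1) {e : T.faces} (he : ¬ T.IsInterior e) :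
    O.reconTrace v e = 0 :=
  if_neg he

end Orientation

variable [NeZero d]

lemma mem_BDM1_of_jump (hΩ : interior (closure Ω) = Ω) (O : T.Orientation) {w : T.VecP1}
    (hw : ∀ e : T.faces, ∀ x ∈ convexHull ℝ (e.1 : Set (E d)),
      inner ℝ (O.jump e fun K => w K x) (O.normal e) = 0) : w ∈ T.BDM1 := by
  have hwc := fun K => (w K).continuous_of_finiteDimensional
  refine ⟨memLp_glue hwc, T.scalFun fun K => divergence (w K),
    memLp_glue fun _ => continuous_const, fun φ hφ => ?_⟩
  have hφ1 : ContDiff ℝ 1 φ := hφ.1.of_le (by exact_mod_cast le_top)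
  have hφc := hφ1.continuous
  have hφd := hφ1.continuous_fderiv one_ne_zero
  have hfderiv (x : E d) : fderiv ℝ φ x (T.vecFun w x)
      = T.glue (fun K y => fderiv ℝ φ y (w K y)) x :=
    map_glue _ (fun x => (fderiv ℝ φ x : E d →+ ℝ)) x
  have hdiv (x : E d) : T.scalFun (fun K => divergence (w K)) x * φ x
      = T.glue (fun K y => φ y * divergence (w K)) x := by
    rw [mul_comm]
    exact map_glue _ (fun x => AddMonoidHom.mulLeft (φ x)) x
  simp only [hfderiv, hdiv]
  rw [setIntegral_glue hΩ fun K => hφd.clm_apply (hwc K), setIntegral_glue hΩ fun K => by fun_prop,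
    eq_neg_iff_add_eq_zero, ← Finset.sum_add_distrib]
  have hadd (K : T.elems) := elemIntegral_add K (hφd.clm_apply (hwc K))
    (g := fun x => φ x * divergence (w K)) (by fun_prop)
  simp only [← hadd]
  rw [sum_elemIntegral_fderiv_add_divergence O w hφ1]
  refine Finset.sum_eq_zero fun e _ => ?_
  rw [faceIntegral_congr (g := fun _ => 0) fun x hx => by simp only [hw e x hx, mul_zero],
    faceIntegral_const, mul_zero]

namespace Orientation

variable (O : T.Orientation)

lemma exists_affineMap_inner_normal (K : T.elems) (τ : T.faces → E d →ᵃ[ℝ] ℝ) :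
    ∃ w : E d →ᵃ[ℝ] E d, ∀ e : T.faces, e.1 ⊆ K.1 →
      EqOn (fun x => inner ℝ (w x) (O.normal e)) (τ e) (convexHull ℝ (e.1 : Set (E d))) := by
  classical
  obtain ⟨w, hw⟩ := exists_affineMap_inner_outwardNormal (elemBasis K) fun a =>
    if K = O.plus (faceOf K a) then τ (faceOf K a) else -τ (faceOf K a)
  refine ⟨w, fun e he x hx => ?_⟩
  obtain ⟨a, rfl⟩ := exists_eq_faceOf he
  have hxa := hw a (facet_elemBasis K a ▸ hx)
  simp only [← O.outNormal_faceOf, outNormal] at hxa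
  simp only [real_inner_comm (O.normal _)]
  split_ifs at hxa
  · exact hxa
  · simpa only [inner_neg_left, AffineMap.coe_neg, Pi.neg_apply, neg_inj] using hxa

lemma eq_of_inner_normal_eq {K : T.elems} {w w' : E d →ᵃ[ℝ] E d}
    (h : ∀ e : T.faces, e.1 ⊆ K.1 → ∀ x ∈ convexHull ℝ (e.1 : Set (E d)),
      inner ℝ (w x) (O.normal e) = inner ℝ (w' x) (O.normal e)) : w = w' := by
  rw [← sub_eq_zero]
  refine eq_zero_of_inner_outwardNormal_eq_zero (elemBasis K) fun a x hx => ?_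
  rw [← O.outNormal_faceOf, real_inner_comm, AffineMap.coe_sub, Pi.sub_apply, inner_sub_left,
    sub_eq_zero]
  have hx := h (faceOf K a) (faceOf_subset K a) x (facet_elemBasis K a ▸ hx)
  unfold outNormal
  split_ifs
  · exact hx
  · rw [inner_neg_right, inner_neg_right, hx]

/-- Test with `p = f - g`. -/
lemma eqOn_of_forall_faceIntegral_mul_eq {e : T.faces} {f g : E d →ᵃ[ℝ] ℝ}
    (h : ∀ p : E d →ᵃ[ℝ] ℝ,
      T.faceIntegral e (fun x => f x * p x) = T.faceIntegral e (fun x => g x * p x)) :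
    EqOn f g (convexHull ℝ (e.1 : Set (E d))) := by
  obtain ⟨K, a, rfl⟩ := exists_elem_eq_faceOf e
  have hf := f.continuous_of_finiteDimensional
  have hg := g.continuous_of_finiteDimensional
  have hsq : T.faceIntegral (faceOf K a) (fun x => ‖(f - g) x‖ ^ 2) = 0 := by
    have hexpand (x : E d) : ‖(f - g) x‖ ^ 2 = f x * (f - g) x + -1 * (g x * (f - g) x) := by
      rw [Real.norm_eq_abs, sq_abs, AffineMap.coe_sub, Pi.sub_apply]
      ring
    simp only [hexpand]
    rw [faceIntegral_add _ (by fun_prop) (by fun_prop), faceIntegral_const_mul, h]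
    ring
  rw [faceIntegral_faceOf] at hsq
  intro x hx
  exact sub_eq_zero.1
    (eqOn_zero_of_integral_norm_sq_facet (elemBasis K) a hsq (facet_elemBasis K a ▸ hx))

/-- The moments determine the normal components because these are affine on each face. -/
theorem isReconstruction_iff (hΩ : interior (closure Ω) = Ω) {v w : T.VecP1} :
    O.IsReconstruction v w ↔ ∀ (e : T.faces) (K : T.elems), e.1 ⊆ K.1 →
      EqOn (fun x => inner ℝ (w K x) (O.normal e)) (O.reconTrace v e)
        (convexHull ℝ (e.1 : Set (E d))) := by
  constructor
  · rintro ⟨-, hint, hbdry⟩ e K he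
    have hcomp : (fun x => inner ℝ (w K x) (O.normal e))
        = (innerₛₗ ℝ (O.normal e)).toAffineMap.comp (w K) :=
      funext fun x => real_inner_comm _ _
    rw [hcomp]
    refine eqOn_of_forall_faceIntegral_mul_eq fun p => ?_
    simp only [← hcomp]
    by_cases hi : T.IsInterior e
    · simp only [hint e hi K he, O.reconTrace_of_isInterior v hi]
    · rw [hbdry e hi K he, O.reconTrace_of_not_isInterior v hi]
      simp only [AffineMap.coe_zero, Pi.zero_apply, zero_mul, faceIntegral_const, mul_zero]
  · intro h
    refine ⟨mem_BDM1_of_jump hΩ O fun e x hx => ?_, fun e hi K he p => ?_, fun e hi K he p => ?_⟩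
    · unfold jump
      have hplus : inner ℝ (w (O.plus e) x) (O.normal e) = _ := h e _ (O.subset_plus e) hx
      have hminus : inner ℝ (w (O.minus e) x) (O.normal e) = _ := h e _ (O.subset_minus e) hx
      split_ifs with hi
      · rw [inner_sub_left, hplus, hminus, sub_self]
      · rw [hplus, O.reconTrace_of_not_isInterior v hi, AffineMap.coe_zero, Pi.zero_apply]
    · exact faceIntegral_congr fun x hx =>
        congrArg (· * p x) ((h e K he hx).trans (O.reconTrace_of_isInterior v hi x))
    · rw [faceIntegral_congr (g := fun _ => 0) fun x hx => ?_, faceIntegral_const, mul_zero]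
      have hx : inner ℝ (w K x) (O.normal e) = _ := h e K he hx
      simp only [hx, O.reconTrace_of_not_isInterior v hi, AffineMap.coe_zero, Pi.zero_apply,
        zero_mul]

theorem existsUnique_isReconstruction (hΩ : interior (closure Ω) = Ω) (v : T.VecP1) :
    ∃! w, O.IsReconstruction v w := by
  choose w hw using fun K => O.exists_affineMap_inner_normal K (O.reconTrace v)
  refine ⟨w, (O.isReconstruction_iff hΩ).2 fun e K => hw K e, fun w' hw' => funext fun K => ?_⟩
  exact O.eq_of_inner_normal_eq fun e he x hx =>
    ((O.isReconstruction_iff hΩ).1 hw' e K he hx).trans (hw K e he hx).symm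

end Orientation

end Mesh

/-! ### Coercivity of the interior penalty form -/

section Frobenius

variable {d : ℕ}

lemma frob_self (L : E d →ₗ[ℝ] E d) :
    Mesh.frob L L = ∑ i, ‖L (EuclideanSpace.single i 1)‖ ^ 2 := by
  simp only [Mesh.frob, real_inner_self_eq_norm_sq]

lemma frob_self_nonneg (L : E d →ₗ[ℝ] E d) : 0 ≤ Mesh.frob L L :=
  frob_self L ▸ Finset.sum_nonneg fun _ _ => sq_nonneg _

lemma norm_apply_sq_le_frob (L : E d →ₗ[ℝ] E d) (x : E d) :
    ‖L x‖ ^ 2 ≤ Mesh.frob L L * ‖x‖ ^ 2 := by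
  have hx : L x = ∑ i, x i • L (EuclideanSpace.single i 1) := by
    nth_rewrite 1 [← (EuclideanSpace.basisFun (Fin d) ℝ).sum_repr x]
    simp only [map_sum, map_smul, EuclideanSpace.basisFun_repr, EuclideanSpace.basisFun_apply]
  have hle : ‖L x‖ ≤ ∑ i, ‖x i‖ * ‖L (EuclideanSpace.single i 1)‖ := by
    rw [hx]
    exact (norm_sum_le _ _).trans (Finset.sum_le_sum fun i _ => (norm_smul _ _).le)
  calc ‖L x‖ ^ 2 ≤ (∑ i, ‖x i‖ * ‖L (EuclideanSpace.single i 1)‖) ^ 2 := by gcongr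
    _ ≤ (∑ i, ‖x i‖ ^ 2) * ∑ i, ‖L (EuclideanSpace.single i 1)‖ ^ 2 :=
      Finset.sum_mul_sq_le_sq_mul_sq _ _ _
    _ = Mesh.frob L L * ‖x‖ ^ 2 := by rw [frob_self, EuclideanSpace.norm_sq_eq, mul_comm]

lemma eq_zero_of_frob_self {L : E d →ₗ[ℝ] E d} (h : Mesh.frob L L = 0) : L = 0 := by
  ext1 x
  have hx := norm_apply_sq_le_frob L x
  rw [h, zero_mul] at hx
  exact norm_eq_zero.1 (sq_eq_zero_iff.1 (le_antisymm hx (sq_nonneg _)))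

end Frobenius

lemma two_mul_inner_le {F : Type*} [NormedAddCommGroup F] [InnerProductSpace ℝ F] {ε : ℝ}
    (hε : 0 < ε) (x y : F) : 2 * inner ℝ x y ≤ ε * ‖x‖ ^ 2 + ε⁻¹ * ‖y‖ ^ 2 := by
  have hsq : 0 ≤ ε * ‖x - ε⁻¹ • y‖ ^ 2 := by positivity
  rw [norm_sub_sq_real, inner_smul_right, norm_smul, mul_pow, Real.norm_eq_abs, sq_abs] at hsq
  have hexpand : ε * (‖x‖ ^ 2 - 2 * (ε⁻¹ * inner ℝ x y) + ε⁻¹ ^ 2 * ‖y‖ ^ 2)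
      = ε * ‖x‖ ^ 2 + ε⁻¹ * ‖y‖ ^ 2 - 2 * inner ℝ x y := by
    field_simp
    ring
  linarith

lemma addHaar_real_le_diam_pow {V : Type*} [NormedAddCommGroup V] [NormedSpace ℝ V]
    [MeasurableSpace V] [BorelSpace V] [FiniteDimensional ℝ V] (μ : Measure V) [μ.IsAddHaarMeasure]
    {s : Set V} (hs : Bornology.IsBounded s) :
    μ.real s ≤ Metric.diam s ^ Module.finrank ℝ V * μ.real (Metric.ball 0 1) := by
  obtain rfl | ⟨x, hx⟩ := s.eq_empty_or_nonempty
  · rw [measureReal_empty]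
    positivity
  have hball : s ⊆ Metric.closedBall x (Metric.diam s) := fun y hy =>
    Metric.dist_le_diam_of_mem hs hy hx
  rw [← Measure.addHaar_real_closedBall μ x Metric.diam_nonneg]
  exact measureReal_mono hball Metric.isBounded_closedBall.measure_lt_top.ne

section Inradius

variable {ι V : Type*} [Finite ι] [Nontrivial ι] [NormedAddCommGroup V] [InnerProductSpace ℝ V]
  [FiniteDimensional ℝ V]

lemma le_height_of_closedBall_subset (b : AffineBasis ι ℝ V) (i : ι) {c : V} {r : ℝ} (hr : 0 ≤ r)
    (hball : Metric.closedBall c r ⊆ convexHull ℝ (range b)) : r ≤ height b i := by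
  have := Fintype.ofFinite ι
  have hnonneg {x : V} (hx : x ∈ convexHull ℝ (range b)) (j : ι) : 0 ≤ b.coord j x := by
    rw [b.convexHull_eq_nonneg_coord] at hx
    exact hx j
  have hle {x : V} (hx : x ∈ convexHull ℝ (range b)) : b.coord i x ≤ 1 :=
    b.sum_coord_apply_eq_one x ▸
      Finset.single_le_sum (f := fun j => b.coord j x) (fun j _ => hnonneg hx j) (Finset.mem_univ i)
  have hν := norm_outwardNormal b i
  have hshift : b.coord i (c - r • outwardNormal b i) = b.coord i c + r / height b i := by
    have hinner := inner_outwardNormal b i (outwardNormal b i)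
    rw [real_inner_self_eq_norm_sq, hν, one_pow] at hinner
    have hlin : (b.coord i).linear (outwardNormal b i) = -(height b i)⁻¹ := by
      rw [eq_neg_iff_add_eq_zero, ← mul_right_inj' (height_pos b i).ne', mul_add,
        mul_inv_cancel₀ (height_pos b i).ne']
      linarith
    rw [← sub_eq_iff_eq_add', ← coord_linear_sub, sub_sub_cancel_left, map_neg, map_smul, hlin,
      smul_eq_mul, mul_neg, neg_neg, div_eq_mul_inv]
  have hmem : c - r • outwardNormal b i ∈ Metric.closedBall c r := by
    rw [mem_closedBall_iff_norm, sub_sub_cancel_left, norm_neg, norm_smul, hν, mul_one,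
      Real.norm_of_nonneg hr]
  have hsum : r / height b i ≤ 1 := by
    linarith [hle (hball hmem), hnonneg (hball (Metric.mem_closedBall_self hr)) i]
  exact (div_le_one (height_pos b i)).1 hsum

end Inradius

namespace Mesh

variable {d : ℕ} {Ω : Set (E d)} {T : Mesh d Ω} {σ : ℝ}

section TraceInequality

lemma IsShapeRegular.diam_le_mul_height [NeZero d] (hσ : T.IsShapeRegular σ) (K : T.elems)
    (a : K.1) :
    Metric.diam (convexHull ℝ (K.1 : Set (E d))) ≤ |σ| * height (elemBasis K) a := by
  obtain ⟨c, r, hr, hball, hdiam⟩ := hσ K.1 K.2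
  calc Metric.diam (convexHull ℝ (K.1 : Set (E d))) ≤ σ * r := hdiam
    _ ≤ |σ| * r := by gcongr; exact le_abs_self σ
    _ ≤ |σ| * height (elemBasis K) a := by
      gcongr
      exact le_height_of_closedBall_subset (elemBasis K) a hr.le (by rwa [range_elemBasis])

/-- The constant of the bound `|e| ≤ C h_K ^ (d - 1)` on shape-regular meshes. -/
noncomputable def faceAreaConst (d : ℕ) (σ : ℝ) : ℝ :=
  d * volume.real (Metric.ball (0 : E d) 1) * |σ|

lemma faceAreaConst_nonneg (d : ℕ) (σ : ℝ) : 0 ≤ faceAreaConst d σ := by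
  unfold faceAreaConst
  positivity

lemma IsShapeRegular.faceArea_le [NeZero d] (hσ : T.IsShapeRegular σ) (K : T.elems) (a : K.1) :
    T.faceArea (faceOf K a)
      ≤ faceAreaConst d σ * Metric.diam (convexHull ℝ (K.1 : Set (E d))) ^ (d - 1) := by
  set D := Metric.diam (convexHull ℝ (K.1 : Set (E d)))
  have : 0 ≤ D := Metric.diam_nonneg
  have hvol : T.elemVol K ≤ D ^ d * volume.real (Metric.ball (0 : E d) 1) := by
    have h := addHaar_real_le_diam_pow volume (isCompact_hull K.1).isBounded
    rwa [finrank_euclideanSpace_fin] at h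
  refine le_of_mul_le_mul_left ?_ (height_pos (elemBasis K) a)
  calc height (elemBasis K) a * T.faceArea (faceOf K a) = d * T.elemVol K :=
        (dim_mul_elemVol K a).symm
    _ ≤ d * (D ^ d * volume.real (Metric.ball (0 : E d) 1)) := by gcongr
    _ = d * volume.real (Metric.ball (0 : E d) 1) * D ^ (d - 1) * D := by
      rw [← pow_sub_one_mul (NeZero.ne d)]
      ring
    _ ≤ d * volume.real (Metric.ball (0 : E d) 1) * D ^ (d - 1)
          * (|σ| * height (elemBasis K) a) := by
      gcongr
      exact hσ.diam_le_mul_height K a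
    _ = height (elemBasis K) a * (faceAreaConst d σ * D ^ (d - 1)) := by
      rw [faceAreaConst]
      ring

lemma faceSize_pos [NeZero d] (e : T.faces) : 0 < T.faceSize e :=
  Real.rpow_pos_of_pos (faceArea_pos e) _

lemma IsShapeRegular.faceSize_le [d.AtLeastTwo] (hσ : T.IsShapeRegular σ) (K : T.elems)
    (a : K.1) :
    T.faceSize (faceOf K a) ≤ faceAreaConst d σ ^ (1 / ((d : ℝ) - 1))
      * Metric.diam (convexHull ℝ (K.1 : Set (E d))) := by
  have hd : 2 ≤ d := Nat.AtLeastTwo.prop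
  set D := Metric.diam (convexHull ℝ (K.1 : Set (E d)))
  have hD : 0 ≤ D := Metric.diam_nonneg
  have hroot : (D ^ (d - 1)) ^ (1 / ((d : ℝ) - 1)) = D := by
    rw [one_div, ← Nat.cast_pred (by lia), Real.pow_rpow_inv_natCast hD (by lia)]
  have hexp : (0 : ℝ) ≤ 1 / ((d : ℝ) - 1) :=
    one_div_nonneg.2 (sub_nonneg.2 (Nat.one_le_cast.2 (by lia)))
  calc T.faceSize (faceOf K a) = T.faceArea (faceOf K a) ^ (1 / ((d : ℝ) - 1)) := rfl
    _ ≤ (faceAreaConst d σ * D ^ (d - 1)) ^ (1 / ((d : ℝ) - 1)) :=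
      Real.rpow_le_rpow (faceArea_pos _).le (hσ.faceArea_le K a) hexp
    _ = faceAreaConst d σ ^ (1 / ((d : ℝ) - 1)) * D := by
      rw [Real.mul_rpow (faceAreaConst_nonneg d σ) (pow_nonneg hD _), hroot]

/-- The constant of the discrete trace inequality `h_e |e| ≤ C |K|` on shape-regular meshes. -/
noncomputable def traceConst (d : ℕ) (σ : ℝ) : ℝ :=
  faceAreaConst d σ ^ (1 / ((d : ℝ) - 1)) * |σ| * d

lemma traceConst_nonneg (d : ℕ) (σ : ℝ) : 0 ≤ traceConst d σ := by
  have := faceAreaConst_nonneg d σ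
  unfold traceConst
  positivity

lemma IsShapeRegular.faceSize_mul_faceArea_le [d.AtLeastTwo] (hσ : T.IsShapeRegular σ)
    {K : T.elems} {e : T.faces} (he : e.1 ⊆ K.1) :
    T.faceSize e * T.faceArea e ≤ traceConst d σ * T.elemVol K := by
  obtain ⟨a, rfl⟩ := exists_eq_faceOf he
  have hroot := Real.rpow_nonneg (faceAreaConst_nonneg d σ) (1 / ((d : ℝ) - 1))
  have hsize : T.faceSize (faceOf K a) ≤ faceAreaConst d σ ^ (1 / ((d : ℝ) - 1))
      * (|σ| * height (elemBasis K) a) :=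
    (hσ.faceSize_le K a).trans (mul_le_mul_of_nonneg_left (hσ.diam_le_mul_height K a) hroot)
  calc T.faceSize (faceOf K a) * T.faceArea (faceOf K a)
      ≤ faceAreaConst d σ ^ (1 / ((d : ℝ) - 1)) * (|σ| * height (elemBasis K) a)
          * T.faceArea (faceOf K a) := mul_le_mul_of_nonneg_right hsize (faceArea_pos _).le
    _ = faceAreaConst d σ ^ (1 / ((d : ℝ) - 1)) * |σ| * (d * T.elemVol K) := by
      rw [dim_mul_elemVol K a]
      ring
    _ = traceConst d σ * T.elemVol K := by
      rw [traceConst]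
      ring

lemma IsShapeRegular.faceSize_mul_faceArea_mul_norm_sq_le [d.AtLeastTwo]
    (hσ : T.IsShapeRegular σ) {K : T.elems} {e : T.faces} (he : e.1 ⊆ K.1) (L : E d →ₗ[ℝ] E d)
    {N : E d} (hN : ‖N‖ = 1) :
    T.faceSize e * T.faceArea e * ‖L N‖ ^ 2 ≤ traceConst d σ * (T.elemVol K * frob L L) := by
  have hL : ‖L N‖ ^ 2 ≤ frob L L := by
    simpa only [hN, one_pow, mul_one] using norm_apply_sq_le_frob L N
  rw [← mul_assoc]
  exact mul_le_mul (hσ.faceSize_mul_faceArea_le he) hL (sq_nonneg _)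
    (mul_nonneg (traceConst_nonneg d σ) (elemVol_pos K).le)

end TraceInequality

/-- The broken Dirichlet energy. -/
noncomputable def gradEnergy (T : Mesh d Ω) (v : T.VecP1) : ℝ :=
  ∑ K : T.elems, T.elemVol K * frob (v K).linear (v K).linear

lemma gradEnergy_nonneg (v : T.VecP1) : 0 ≤ T.gradEnergy v :=
  Finset.sum_nonneg fun K _ => mul_nonneg (elemVol_pos K).le (frob_self_nonneg _)

lemma linear_eq_zero_of_gradEnergy_eq_zero {v : T.VecP1} (h : T.gradEnergy v = 0) (K : T.elems) :
    (v K).linear = 0 := by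
  have hK := (Finset.sum_eq_zero_iff_of_nonneg fun K _ =>
    mul_nonneg (elemVol_pos K).le (frob_self_nonneg (v K).linear)).1 h K (Finset.mem_univ K)
  exact eq_zero_of_frob_self ((mul_eq_zero.1 hK).resolve_left (elemVol_pos K).ne')

namespace Orientation

variable (O : T.Orientation)

/-- The energy of the jumps on the face `e`. -/
noncomputable def jumpEnergy (v : T.VecP1) (e : T.faces) : ℝ :=
  T.faceIntegral e fun x =>
    (T.faceSize e)⁻¹ * inner ℝ (O.jump e fun K => v K x) (O.jump e fun K => v K x)

lemma a_self (ν ρ : ℝ) (v : T.VecP1) :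
    O.a ν ρ v v = ν * (T.gradEnergy v - 2 * O.consistency v v + ρ * ∑ e, O.jumpEnergy v e) := by
  unfold a gradEnergy jumpEnergy
  simp only [elemIntegral_const]
  ring

open Classical in
lemma norm_avg_sq_le {F : Type*} [NormedAddCommGroup F] [InnerProductSpace ℝ F] (e : T.faces)
    (y : T.elems → F) :
    ‖O.avg e y‖ ^ 2 ≤ ‖y (O.plus e)‖ ^ 2 + if T.IsInterior e then ‖y (O.minus e)‖ ^ 2 else 0 := by
  unfold avg
  split_ifs
  · rw [norm_smul, mul_pow, Real.norm_eq_abs, sq_abs]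
    linarith [parallelogram_law_with_norm ℝ (y (O.plus e)) (y (O.minus e)),
      sq_nonneg ‖y (O.plus e) - y (O.minus e)‖, sq_nonneg ‖y (O.plus e)‖,
      sq_nonneg ‖y (O.minus e)‖]
  · rw [add_zero]

variable [NeZero d]

lemma jumpEnergy_nonneg (v : T.VecP1) (e : T.faces) : 0 ≤ O.jumpEnergy v e :=
  integral_nonneg fun _ => mul_nonneg (inv_nonneg.2 (faceSize_pos e).le) real_inner_self_nonneg

lemma two_faceIntegral_inner_jump_le (v : T.VecP1) (e : T.faces) (g : E d) {ε : ℝ} (hε : 0 < ε) :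
    2 * T.faceIntegral e (fun x => inner ℝ g (O.jump e fun K => v K x))
      ≤ ε * (T.faceSize e * T.faceArea e * ‖g‖ ^ 2) + ε⁻¹ * O.jumpEnergy v e := by
  have hjump := continuous_jump O v e
  have hconst : ε * (T.faceSize e * T.faceArea e * ‖g‖ ^ 2)
      = T.faceIntegral e fun _ => ε * T.faceSize e * ‖g‖ ^ 2 := by
    rw [faceIntegral_const]
    ring
  rw [hconst, jumpEnergy, ← faceIntegral_const_mul, ← faceIntegral_const_mul,
    ← faceIntegral_add e continuous_const (by fun_prop)]
  refine integral_mono (integrableOn_face e (by fun_prop)) (integrableOn_face e (by fun_prop))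
    fun x => (two_mul_inner_le (mul_pos hε (faceSize_pos e)) _ _).trans_eq ?_
  rw [real_inner_self_eq_norm_sq, mul_inv, mul_assoc ε⁻¹]

end Orientation

namespace Orientation

variable [d.AtLeastTwo] (O : T.Orientation)

/-- Each element contributes to the `d + 1` terms of its own faces. -/
lemma two_consistency_le (hσ : T.IsShapeRegular σ) (v : T.VecP1) {ε : ℝ} (hε : 0 < ε) :
    2 * O.consistency v v
      ≤ ε * ((d + 1) * traceConst d σ) * T.gradEnergy v + ε⁻¹ * ∑ e, O.jumpEnergy v e := by
  classical
  set X : T.elems → ℝ :=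
    fun K => traceConst d σ * (T.elemVol K * frob (v K).linear (v K).linear)
  have htrace {K : T.elems} {e : T.faces} (he : e.1 ⊆ K.1) :
      T.faceSize e * T.faceArea e * ‖(v K).linear (O.normal e)‖ ^ 2 ≤ X K :=
    hσ.faceSize_mul_faceArea_mul_norm_sq_le he _ (O.outward e).1
  have havg (e : T.faces) : T.faceSize e * T.faceArea e
        * ‖O.avg e fun K => (v K).linear (O.normal e)‖ ^ 2
      ≤ X (O.plus e) + if T.IsInterior e then X (O.minus e) else 0 := by
    refine (mul_le_mul_of_nonneg_left (O.norm_avg_sq_le e _)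
      (mul_pos (faceSize_pos e) (faceArea_pos e)).le).trans ?_
    rw [mul_add]
    refine add_le_add (htrace (O.subset_plus e)) ?_
    split_ifs
    · exact htrace (O.subset_minus e)
    · rw [mul_zero]
  calc 2 * O.consistency v v
      ≤ ∑ e : T.faces, (ε * (X (O.plus e) + if T.IsInterior e then X (O.minus e) else 0)
          + ε⁻¹ * O.jumpEnergy v e) := by
        rw [consistency, Finset.mul_sum]
        exact Finset.sum_le_sum fun e _ => (O.two_faceIntegral_inner_jump_le v e _ hε).trans
          (add_le_add_left (mul_le_mul_of_nonneg_left (havg e) hε.le) _)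
    _ = ε * ∑ K : T.elems, (d + 1 : ℕ) * X K + ε⁻¹ * ∑ e, O.jumpEnergy v e := by
        rw [Finset.sum_add_distrib, ← Finset.mul_sum, ← Finset.mul_sum,
          ← O.sum_elems_sum_faces fun K _ => X K]
        simp only [Finset.sum_const, card_faces_of_elem, nsmul_eq_mul]
    _ = ε * ((d + 1) * traceConst d σ) * T.gradEnergy v + ε⁻¹ * ∑ e, O.jumpEnergy v e := by
        rw [← Finset.mul_sum, ← Finset.mul_sum, gradEnergy]
        push_cast
        ring

/-- The threshold `ρ₀` for the penalty parameter. -/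
noncomputable def penaltyThreshold (d : ℕ) (σ : ℝ) : ℝ :=
  2 * ((d + 1) * traceConst d σ + 1) + 1

lemma penaltyThreshold_pos (d : ℕ) (σ : ℝ) : 0 < penaltyThreshold d σ := by
  have := traceConst_nonneg d σ
  unfold penaltyThreshold
  positivity

theorem energy_le_a_self (hσ : T.IsShapeRegular σ) {ν ρ : ℝ} (hν : 0 ≤ ν)
    (hρ : penaltyThreshold d σ ≤ ρ) (v : T.VecP1) :
    ν * (1 / 2 * T.gradEnergy v + ∑ e, O.jumpEnergy v e) ≤ O.a ν ρ v v := by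
  rw [a_self]
  refine mul_le_mul_of_nonneg_left ?_ hν
  set C := (d + 1) * traceConst d σ with hC
  have hC0 : 0 ≤ C := mul_nonneg (by positivity) (traceConst_nonneg d σ)
  have hcons := O.two_consistency_le hσ v (ε := (2 * (C + 1))⁻¹) (by positivity)
  rw [← hC, inv_inv] at hcons
  have hhalf : (2 * (C + 1))⁻¹ * C ≤ 1 / 2 := by
    rw [inv_mul_le_iff₀ (by positivity)]
    linarith
  have hgrad := mul_le_mul_of_nonneg_right hhalf (gradEnergy_nonneg v)
  have hjump : (2 * (C + 1) + 1) * ∑ e, O.jumpEnergy v e ≤ ρ * ∑ e, O.jumpEnergy v e :=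
    mul_le_mul_of_nonneg_right hρ (Finset.sum_nonneg fun e _ => O.jumpEnergy_nonneg v e)
  linarith

end Orientation

namespace Orientation

variable [NeZero d] (O : T.Orientation)

lemma eq_of_plus_eq_minus (hΩ : interior (closure Ω) = Ω) (hconn : IsPreconnected Ω)
    {X : Type*} {g : T.elems → X} (hg : ∀ e, T.IsInterior e → g (O.plus e) = g (O.minus e))
    (K L : T.elems) : g K = g L := by
  have hplus {e : T.faces} {K : T.elems} (he : e.1 ⊆ K.1) : g K = g (O.plus e) := by
    by_cases hi : T.IsInterior e
    · obtain rfl | rfl := O.eq_plus_or_minus hi he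
      exacts [rfl, (hg e hi).symm]
    · rw [O.eq_plus hi he]
  exact eq_of_eq_of_common_face hΩ hconn (fun e K L hK hL => (hplus hK).trans (hplus hL).symm) K L

lemma eq_zero_of_energy_eq_zero (hΩ : interior (closure Ω) = Ω) (hconn : IsConnected Ω)
    {v : T.VecP1} (hgrad : T.gradEnergy v = 0) (hjump : ∀ e, O.jumpEnergy v e = 0) : v = 0 := by
  have hconst (K : T.elems) (x : E d) : v K x = v K 0 := by
    simpa [linear_eq_zero_of_gradEnergy_eq_zero hgrad K] using
      congrFun (AffineMap.decomp (v K)) x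
  have hjump0 (e : T.faces) : (O.jump e fun K => v K 0) = 0 := by
    have he := hjump e
    simp only [jumpEnergy, hconst, faceIntegral_const] at he
    have he := (mul_eq_zero.1 he).resolve_left (faceArea_pos e).ne'
    exact inner_self_eq_zero.1 ((mul_eq_zero.1 he).resolve_left (inv_pos.2 (faceSize_pos e)).ne')
  have hall := O.eq_of_plus_eq_minus hΩ hconn.isPreconnected (g := fun K => v K 0) fun e he => by
    simpa only [jump, if_pos he, sub_eq_zero] using hjump0 e
  obtain ⟨e, he⟩ := exists_not_isInterior O hconn.nonempty
  have hplus : v (O.plus e) 0 = 0 := by simpa only [jump, if_neg he] using hjump0 e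
  funext K
  ext1 x
  rw [hconst K x, hall K (O.plus e), hplus]
  rfl

end Orientation

namespace Orientation

variable [d.AtLeastTwo] (O : T.Orientation)

theorem eq_zero_of_a_self (hΩ : interior (closure Ω) = Ω) (hconn : IsConnected Ω)
    (hσ : T.IsShapeRegular σ) {ν ρ : ℝ} (hν : 0 < ν) (hρ : penaltyThreshold d σ ≤ ρ)
    {v : T.VecP1} (hv : O.a ν ρ v v = 0) : v = 0 := by
  have hle : 1 / 2 * T.gradEnergy v + ∑ e, O.jumpEnergy v e ≤ 0 :=
    nonpos_of_mul_nonpos_right (hv ▸ O.energy_le_a_self hσ hν.le hρ v) hν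
  have hgrad := gradEnergy_nonneg v
  have hjump (e : T.faces) : 0 ≤ O.jumpEnergy v e := O.jumpEnergy_nonneg v e
  have hsum : 0 ≤ ∑ e, O.jumpEnergy v e := Finset.sum_nonneg fun e _ => hjump e
  refine O.eq_zero_of_energy_eq_zero hΩ hconn (by linarith) fun e => ?_
  exact (Finset.sum_eq_zero_iff_of_nonneg fun e _ => hjump e).1 (by linarith) e (Finset.mem_univ e)

end Orientation

end Mesh

/-! ### The pressure form on the enrichment space -/

lemma inner_outwardNormal_sub_centroid {ι V : Type*} [Fintype ι] [NormedAddCommGroup V]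
    [InnerProductSpace ℝ V] [FiniteDimensional ℝ V] (b : AffineBasis ι ℝ V) (i : ι) {x : V}
    (hx : x ∈ facet b i) :
    inner ℝ (outwardNormal b i) (x - Finset.univ.centroid ℝ b)
      = height b i / Fintype.card ι := by
  rw [inner_outwardNormal, coord_linear_sub, coord_eq_zero_of_mem_facet hx,
    b.coord_apply_centroid (Finset.mem_univ i), zero_sub, mul_neg, neg_neg, Finset.card_univ,
    div_eq_mul_inv]

namespace Mesh

variable {d : ℕ} {Ω : Set (E d)} {T : Mesh d Ω}

lemma centroid_elemBasis (K : T.elems) :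
    Finset.univ.centroid ℝ (elemBasis K) = K.1.centroid ℝ id :=
  (K.1.centroid_univ ℝ).symm ▸ rfl

/-- The element `x ↦ c_K (x - x_K)` of the enrichment space `D_h`. -/
noncomputable def enrichment (T : Mesh d Ω) (c : T.elems → ℝ) : T.VecP1 := fun K =>
  c K • (AffineMap.id ℝ (E d) - AffineMap.const ℝ (E d) (K.1.centroid ℝ id))

lemma enrichment_apply (c : T.elems → ℝ) (K : T.elems) (x : E d) :
    T.enrichment c K x = c K • (x - K.1.centroid ℝ id) :=
  rfl

lemma enrichment_mem_Dh (c : T.elems → ℝ) : T.enrichment c ∈ T.Dh :=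
  fun K => ⟨c K, enrichment_apply c K⟩

lemma mem_Qh_iff (hΩ : interior (closure Ω) = Ω) {q : T.ScalP0} :
    q ∈ T.Qh ↔ ∑ K : T.elems, T.elemVol K * q K = 0 := by
  simp only [Qh, mem_ofPred_eq, scalFun, setIntegral_glue hΩ fun _ => continuous_const,
    elemIntegral_const]

lemma eq_zero_of_mem_Qh (hΩ : interior (closure Ω) = Ω) (hne : Ω.Nonempty) {q : T.ScalP0}
    (hq : q ∈ T.Qh) (hconst : ∀ K L, q K = q L) : q = 0 := by
  have := elems_nonempty (T := T) hne
  rw [mem_Qh_iff hΩ] at hq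
  have hvol : 0 < ∑ K : T.elems, T.elemVol K :=
    Finset.sum_pos (fun K _ => elemVol_pos K) Finset.univ_nonempty
  funext K
  simp only [hconst _ K, ← Finset.sum_mul] at hq
  exact (mul_eq_zero.1 hq).resolve_left hvol.ne'

variable [NeZero d]

namespace Orientation

variable (O : T.Orientation)

lemma faceArea_mul_inner_sub_centroid {K : T.elems} {e : T.faces} (he : e.1 ⊆ K.1) {x : E d}
    (hx : x ∈ convexHull ℝ (e.1 : Set (E d))) :
    T.faceArea e * inner ℝ (x - K.1.centroid ℝ id) (O.outNormal K e)
      = d / (d + 1) * T.elemVol K := by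
  obtain ⟨a, rfl⟩ := exists_eq_faceOf he
  rw [← facet_elemBasis] at hx
  have hcard : (Fintype.card K.1 : ℝ) = d + 1 := by
    rw [Fintype.card_coe, card_elem, Nat.cast_add_one]
  rw [← centroid_elemBasis, real_inner_comm, outNormal_faceOf,
    inner_outwardNormal_sub_centroid _ _ hx, hcard, div_mul_eq_mul_div, dim_mul_elemVol K a,
    mul_div_assoc', mul_comm]

lemma b_eq_sum_faceIntegral (w : T.VecP1) (q : T.ScalP0) :
    O.b w q = ∑ e : T.faces, T.faceIntegral e fun x =>
      inner ℝ (O.jump e fun K => q K • w K x) (O.normal e)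
        - inner ℝ (O.jump e fun K => w K x) (O.normal e) * O.avg e q := by
  have hdiv (K : T.elems) : divergence (q K • w K) = divergence (w K) * q K := by
    rw [divergence, AffineMap.smul_linear, map_smul, smul_eq_mul, mul_comm, divergence]
  have hparts := sum_elemIntegral_fderiv_add_divergence O (fun K => q K • w K)
    (φ := fun _ => 1) contDiff_const
  simp only [fderiv_fun_const, Pi.zero_apply, _root_.zero_apply, zero_add,
    one_mul, hdiv] at hparts
  rw [b, hparts, ← Finset.sum_sub_distrib]
  refine Finset.sum_congr rfl fun e _ => ?_
  have hjump := continuous_jump O w e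
  have hjump' := continuous_jump O (fun K => q K • w K) e
  exact (integral_sub (integrableOn_face e (by fun_prop)) (integrableOn_face e (by fun_prop))).symm

lemma inner_enrichment_outNormal (q : T.ScalP0) {K : T.elems} {e : T.faces} (he : e.1 ⊆ K.1)
    {x : E d} (hx : x ∈ convexHull ℝ (e.1 : Set (E d))) :
    inner ℝ (T.enrichment (fun K => q K / T.elemVol K) K x) (O.outNormal K e)
      = (T.faceArea e)⁻¹ * (d / (d + 1) * q K) := by
  rw [enrichment_apply, real_inner_smul_left, eq_inv_mul_iff_mul_eq₀ (faceArea_pos e).ne',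
    mul_left_comm, O.faceArea_mul_inner_sub_centroid he hx, mul_left_comm,
    div_mul_cancel₀ _ (elemVol_pos K).ne']

open Classical in
lemma b_enrichment (q : T.ScalP0) :
    O.b (T.enrichment fun K => q K / T.elemVol K) q
      = ∑ e : T.faces, if T.IsInterior e then
          d / (d + 1) / 2 * (q (O.plus e) - q (O.minus e)) ^ 2 else 0 := by
  rw [b_eq_sum_faceIntegral]
  refine Finset.sum_congr rfl fun e _ => ?_
  split_ifs with he
  · rw [faceIntegral_congr (g := fun _ => (T.faceArea e)⁻¹ *
      (d / (d + 1) / 2 * (q (O.plus e) - q (O.minus e)) ^ 2)), faceIntegral_const,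
      mul_inv_cancel_left₀ (faceArea_pos e).ne']
    intro x hx
    have hplus := O.inner_enrichment_outNormal q (O.subset_plus e) hx
    have hminus := O.inner_enrichment_outNormal q (O.subset_minus e) hx
    rw [O.outNormal_plus] at hplus
    rw [O.outNormal_minus he, inner_neg_right, neg_eq_iff_eq_neg] at hminus
    simp only [jump, avg, if_pos he, inner_sub_left, real_inner_smul_left, hplus, hminus,
      smul_eq_mul]
    ring
  · rw [faceIntegral_congr (g := fun _ => 0) fun x _ => by
      simp only [jump, avg, if_neg he, real_inner_smul_left]
      ring, faceIntegral_const, mul_zero]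

theorem eq_of_b_enrichment (hΩ : interior (closure Ω) = Ω) (hconn : IsPreconnected Ω)
    {q : T.ScalP0} (hq : O.b (T.enrichment fun K => q K / T.elemVol K) q = 0) (K L : T.elems) :
    q K = q L := by
  classical
  have hd : (0 : ℝ) < d := Nat.cast_pos.2 (Nat.pos_of_neZero d)
  rw [b_enrichment, Finset.sum_eq_zero_iff_of_nonneg fun e _ => by split_ifs <;> positivity] at hq
  refine O.eq_of_plus_eq_minus hΩ hconn (fun e he => ?_) K L
  have hsq := hq e (Finset.mem_univ e)
  rw [if_pos he, mul_eq_zero, or_iff_right (by positivity)] at hsq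
  exact sub_eq_zero.1 (sq_eq_zero_iff.1 hsq)

end Orientation

end Mesh

/-! ### The velocity space -/

section Convergence

variable {X F : Type*} [MeasurableSpace X] {μ : Measure X} [NormedAddCommGroup F]
  {p : ENNReal} {f g : ℕ → X → F} {u v : X → F}

lemma tendsto_eLpNorm_add_sub_add (hp : 1 ≤ p) (hf : ∀ k, AEStronglyMeasurable (f k) μ)
    (hg : ∀ k, AEStronglyMeasurable (g k) μ) (hu : AEStronglyMeasurable u μ)
    (hv : AEStronglyMeasurable v μ)
    (hfu : Tendsto (fun k => eLpNorm (fun x => f k x - u x) p μ) atTop (𝓝 0))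
    (hgv : Tendsto (fun k => eLpNorm (fun x => g k x - v x) p μ) atTop (𝓝 0)) :
    Tendsto (fun k => eLpNorm (fun x => f k x + g k x - (u x + v x)) p μ) atTop (𝓝 0) := by
  have hsum := hfu.add hgv
  rw [add_zero] at hsum
  refine tendsto_of_tendsto_of_tendsto_of_le_of_le tendsto_const_nhds hsum (fun _ => zero_le)
    fun k => ?_
  simp only [add_sub_add_comm]
  exact eLpNorm_add_le ((hf k).sub hu) ((hg k).sub hv) hp

lemma tendsto_eLpNorm_smul_sub_smul [NormedSpace ℝ F] (c : ℝ)
    (hfu : Tendsto (fun k => eLpNorm (fun x => f k x - u x) p μ) atTop (𝓝 0)) :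
    Tendsto (fun k => eLpNorm (fun x => c • f k x - c • u x) p μ) atTop (𝓝 0) := by
  have hsmul (k : ℕ) : eLpNorm (fun x => c • f k x - c • u x) p μ
      = ‖c‖ₑ * eLpNorm (fun x => f k x - u x) p μ := by
    simp only [← smul_sub]
    exact eLpNorm_const_smul c (fun x => f k x - u x) p μ
  simpa only [hsmul, mul_zero] using ENNReal.Tendsto.const_mul hfu (Or.inr enorm_ne_top)

end Convergence

variable {d : ℕ} {Ω : Set (E d)}

section TestFunction

variable {F : Type*} [NormedAddCommGroup F] [NormedSpace ℝ F] {φ ψ : E d → F}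

lemma IsTestFunction.zero : IsTestFunction Ω (0 : E d → F) :=
  ⟨contDiff_const, HasCompactSupport.zero, by simp only [tsupport_zero, empty_subset]⟩

lemma IsTestFunction.add (hφ : IsTestFunction Ω φ) (hψ : IsTestFunction Ω ψ) :
    IsTestFunction Ω (φ + ψ) :=
  ⟨hφ.1.add hψ.1, hφ.2.1.add hψ.2.1, (tsupport_add φ ψ).trans (union_subset hφ.2.2 hψ.2.2)⟩

lemma IsTestFunction.const_smul (hφ : IsTestFunction Ω φ) (c : ℝ) : IsTestFunction Ω (c • φ) :=
  ⟨hφ.1.const_smul c, hφ.2.1.smul_left (f := fun _ => c),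
    (tsupport_smul_subset_right (fun _ => c) φ).trans hφ.2.2⟩

lemma IsTestFunction.differentiable (hφ : IsTestFunction Ω φ) : Differentiable ℝ φ :=
  hφ.1.differentiable (by simp)

lemma IsTestFunction.continuous_fderiv (hφ : IsTestFunction Ω φ) : Continuous (fderiv ℝ φ) :=
  hφ.1.continuous_fderiv (by simp)

end TestFunction

lemma integrable_smul_of_hasCompactSupport {X F : Type*} [TopologicalSpace X] [MeasurableSpace X]
    [OpensMeasurableSpace X] [SecondCountableTopologyEither X ℝ] [NormedAddCommGroup F]
    [NormedSpace ℝ F] {μ : Measure X} [IsFiniteMeasureOnCompacts μ] {u : X → F} (hu : MemLp u 2 μ)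
    {φ : X → ℝ} (hφ : Continuous φ) (hsupp : HasCompactSupport φ) :
    Integrable (fun x => φ x • u x) μ :=
  memLp_one_iff_integrable.1 (hu.smul (p := 2) (hφ.memLp_of_hasCompactSupport hsupp))

lemma IsWeakGradient.add {u v : E d → E d} {G H : E d → E d →L[ℝ] E d}
    (hu : MemLp u 2 (volume.restrict Ω)) (hv : MemLp v 2 (volume.restrict Ω))
    (hG : MemLp G 2 (volume.restrict Ω)) (hH : MemLp H 2 (volume.restrict Ω))
    (hGu : IsWeakGradient Ω u G) (hHv : IsWeakGradient Ω v H) :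
    IsWeakGradient Ω (u + v) (G + H) := by
  intro θ hθ z
  have hgrad {u : E d → E d} (hu : MemLp u 2 (volume.restrict Ω)) :
      IntegrableOn (fun x => fderiv ℝ θ x z • u x) Ω :=
    integrable_smul_of_hasCompactSupport hu (hθ.continuous_fderiv.clm_apply continuous_const)
      (hθ.2.1.fderiv_apply ℝ z)
  have hval {G : E d → E d →L[ℝ] E d} (hG : MemLp G 2 (volume.restrict Ω)) :
      IntegrableOn (fun x => θ x • G x z) Ω :=
    integrable_smul_of_hasCompactSupport
      ((ContinuousLinearMap.apply ℝ (E d) z).comp_memLp' hG) hθ.1.continuous hθ.2.1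
  simp only [Pi.add_apply, _root_.add_apply, smul_add]
  rw [integral_add (hgrad hu) (hgrad hv), integral_add (hval hG) (hval hH), hGu θ hθ z,
    hHv θ hθ z, neg_add]

lemma IsWeakGradient.const_smul {u : E d → E d} {G : E d → E d →L[ℝ] E d}
    (hGu : IsWeakGradient Ω u G) (c : ℝ) : IsWeakGradient Ω (c • u) (c • G) := by
  intro θ hθ z
  simp only [Pi.smul_apply, _root_.smul_apply, smul_comm _ c]
  rw [integral_smul, integral_smul, hGu θ hθ z, smul_neg]

lemma MemH10.zero : MemH10 Ω 0 := by
  refine ⟨MemLp.zero', 0, MemLp.zero' (ε := E d →L[ℝ] E d), fun φ _ z => ?_,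
    0, fun _ => IsTestFunction.zero, by simp, by simp [eLpNorm_zero' (ε := E d →L[ℝ] E d)]⟩
  simp only [Pi.zero_apply, smul_zero, _root_.zero_apply, integral_zero, neg_zero]

lemma MemH10.add {u v : E d → E d} (hu : MemH10 Ω u) (hv : MemH10 Ω v) : MemH10 Ω (u + v) := by
  obtain ⟨hu2, G, hG, hGu, φ, hφ, hφu, hφG⟩ := hu
  obtain ⟨hv2, H, hH, hHv, ψ, hψ, hψv, hψH⟩ := hv
  have hGH : MemLp (G + H) 2 (volume.restrict Ω) := MemLp.add (ε := E d →L[ℝ] E d) hG hH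
  refine ⟨hu2.add hv2, G + H, hGH, hGu.add hu2 hv2 hG hH hHv, φ + ψ,
    fun k => (hφ k).add (hψ k), ?_, ?_⟩
  · exact tendsto_eLpNorm_add_sub_add one_le_two
      (fun k => (hφ k).1.continuous.aestronglyMeasurable)
      (fun k => (hψ k).1.continuous.aestronglyMeasurable) hu2.1 hv2.1 hφu hψv
  · have hderiv (k : ℕ) (x : E d) :
        fderiv ℝ ((φ + ψ) k) x = fderiv ℝ (φ k) x + fderiv ℝ (ψ k) x :=
      fderiv_add ((hφ k).differentiable x) ((hψ k).differentiable x)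
    simp only [hderiv]
    exact tendsto_eLpNorm_add_sub_add one_le_two
      (fun k => (hφ k).continuous_fderiv.aestronglyMeasurable)
      (fun k => (hψ k).continuous_fderiv.aestronglyMeasurable) hG.1 hH.1 hφG hψH

lemma MemH10.const_smul {u : E d → E d} (hu : MemH10 Ω u) (c : ℝ) : MemH10 Ω (c • u) := by
  obtain ⟨hu2, G, hG, hGu, φ, hφ, hφu, hφG⟩ := hu
  refine ⟨hu2.const_smul c, c • G, hG.const_smul c, hGu.const_smul c, c • φ,
    fun k => (hφ k).const_smul c, tendsto_eLpNorm_smul_sub_smul c hφu, ?_⟩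
  have hderiv (k : ℕ) (x : E d) : fderiv ℝ ((c • φ) k) x = c • fderiv ℝ (φ k) x :=
    fderiv_const_smul ((hφ k).differentiable x) c
  simp only [hderiv]
  exact tendsto_eLpNorm_smul_sub_smul c hφG

namespace Mesh

section Glue

variable {T : Mesh d Ω} {F : Type*} [AddCommGroup F]

lemma glue_add (f g : T.elems → E d → F) : T.glue (f + g) = T.glue f + T.glue g := by
  funext x
  simp only [glue, Pi.add_apply, ← Finset.sum_add_distrib]
  exact Finset.sum_congr rfl fun K _ => congrFun (indicator_add _ _ _) x

lemma glue_smul [Module ℝ F] (c : ℝ) (f : T.elems → E d → F) :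
    T.glue (c • f) = c • T.glue f := by
  funext x
  simp only [glue, Pi.smul_apply, Finset.smul_sum]
  exact Finset.sum_congr rfl fun K _ => congrFun (indicator_const_smul _ c (f K)) x

lemma vecFun_add (v w : T.VecP1) : T.vecFun (v + w) = T.vecFun v + T.vecFun w :=
  glue_add (fun K => v K) fun K => w K

lemma vecFun_smul (c : ℝ) (v : T.VecP1) : T.vecFun (c • v) = c • T.vecFun v :=
  glue_smul c fun K => v K

lemma vecFun_zero : T.vecFun 0 = 0 := by
  simpa only [zero_smul] using T.vecFun_smul 0 0

end Glue

variable (T : Mesh d Ω)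

/-- `C_h` as a subspace. -/
noncomputable def ChSubmodule : Submodule ℝ T.VecP1 where
  carrier := T.Ch
  zero_mem' := by
    rw [Ch, mem_ofPred_eq, vecFun_zero]
    exact MemH10.zero
  add_mem' {v w} hv hw := by
    rw [Ch, mem_ofPred_eq, vecFun_add]
    exact MemH10.add hv hw
  smul_mem' c v hv := by
    rw [Ch, mem_ofPred_eq, vecFun_smul]
    exact MemH10.const_smul hv c

/-- `D_h` as a subspace. -/
noncomputable def DhSubmodule : Submodule ℝ T.VecP1 where
  carrier := T.Dh
  zero_mem' _ := ⟨0, fun _ => (zero_smul ℝ _).symm⟩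
  add_mem' {v w} hv hw K := by
    obtain ⟨c, hc⟩ := hv K
    obtain ⟨c', hc'⟩ := hw K
    exact ⟨c + c', fun x => by
      rw [Pi.add_apply, AffineMap.coe_add, Pi.add_apply, hc, hc', add_smul]⟩
  smul_mem' r v hv K := by
    obtain ⟨c, hc⟩ := hv K
    exact ⟨r * c, fun x => by
      rw [Pi.smul_apply, AffineMap.coe_smul, Pi.smul_apply, hc, mul_smul]⟩

/-- `V_h` as a subspace. -/
noncomputable def VhSubmodule : Submodule ℝ T.VecP1 := T.ChSubmodule ⊔ T.DhSubmodule

lemma mem_VhSubmodule {v : T.VecP1} : v ∈ T.VhSubmodule ↔ v ∈ T.Vh := by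
  simp only [VhSubmodule, Submodule.mem_sup, eq_comm]
  rfl

lemma Dh_subset_Vh : T.Dh ⊆ T.Vh :=
  fun _ hv => T.mem_VhSubmodule.1 ((le_sup_right : T.DhSubmodule ≤ T.VhSubmodule) hv)

end Mesh

/-! ### The discrete problem as a linear system -/

section SaddlePoint

variable {𝕜 X Y : Type*} [Field 𝕜] [AddCommGroup X] [Module 𝕜 X] [AddCommGroup Y] [Module 𝕜 Y]

theorem existsUnique_saddlePoint [FiniteDimensional 𝕜 X] [FiniteDimensional 𝕜 Y]
    (a : X →ₗ[𝕜] X →ₗ[𝕜] 𝕜) (b : X →ₗ[𝕜] Y →ₗ[𝕜] 𝕜)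
    (h : ∀ u p, (∀ v, a u v - b v p = 0) → (∀ q, b u q = 0) → u = 0 ∧ p = 0)
    (ℓ : X →ₗ[𝕜] 𝕜) :
    ∃! up : X × Y, (∀ v, a up.1 v - b v up.2 = ℓ v) ∧ ∀ q, b up.1 q = 0 := by
  let Φ : (X × Y) →ₗ[𝕜] (Module.Dual 𝕜 X × Module.Dual 𝕜 Y) :=
    (a.comp (LinearMap.fst 𝕜 X Y) - b.flip.comp (LinearMap.snd 𝕜 X Y)).prod
      (b.comp (LinearMap.fst 𝕜 X Y))
  have hΦ (up : X × Y) (ℓ : X →ₗ[𝕜] 𝕜) :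
      Φ up = (ℓ, 0) ↔ (∀ v, a up.1 v - b v up.2 = ℓ v) ∧ ∀ q, b up.1 q = 0 := by
    rw [Prod.ext_iff, LinearMap.ext_iff, LinearMap.ext_iff]
    rfl
  have hinj : Function.Injective Φ := by
    rw [injective_iff_map_eq_zero]
    rintro ⟨u, p⟩ hup
    obtain ⟨hv, hq⟩ := (hΦ (u, p) 0).1 hup
    exact Prod.ext_iff.2 (h u p hv hq)
  have hsurj : Function.Surjective Φ :=
    (LinearMap.injective_iff_surjective_of_finrank_eq_finrank (by
      simp only [Module.finrank_prod, Subspace.dual_finrank_eq])).1 hinj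
  simpa only [hΦ] using (show Function.Bijective Φ from ⟨hinj, hsurj⟩).existsUnique (ℓ, 0)

theorem existsUnique_saddlePoint_submodule (a : X →ₗ[𝕜] X →ₗ[𝕜] 𝕜) (b : X →ₗ[𝕜] Y →ₗ[𝕜] 𝕜)
    (V : Submodule 𝕜 X) (Q : Submodule 𝕜 Y) [FiniteDimensional 𝕜 V] [FiniteDimensional 𝕜 Q]
    (h : ∀ u ∈ V, ∀ p ∈ Q, (∀ v ∈ V, a u v - b v p = 0) → (∀ q ∈ Q, b u q = 0) → u = 0 ∧ p = 0)
    (ℓ : X →ₗ[𝕜] 𝕜) :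
    ∃! up : X × Y, up.1 ∈ V ∧ up.2 ∈ Q ∧ (∀ v ∈ V, a up.1 v - b v up.2 = ℓ v) ∧
      ∀ q ∈ Q, b up.1 q = 0 := by
  obtain ⟨⟨u, p⟩, ⟨hv, hq⟩, huniq⟩ := existsUnique_saddlePoint (a.domRestrict₁₂ V V)
    (b.domRestrict₁₂ V Q) (fun u p hv hq =>
      (h u u.2 p p.2 (fun v hvV => hv ⟨v, hvV⟩) fun q hqQ => hq ⟨q, hqQ⟩).imp Subtype.ext
        Subtype.ext) (ℓ.domRestrict V)
  refine ⟨(u, p), ⟨u.2, p.2, fun v hvV => hv ⟨v, hvV⟩, fun q hqQ => hq ⟨q, hqQ⟩⟩, ?_⟩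
  rintro ⟨u', p'⟩ ⟨hu', hp', hv', hq'⟩
  have heq := huniq (⟨u', hu'⟩, ⟨p', hp'⟩) ⟨fun v => hv' v v.2, fun q => hq' q q.2⟩
  simp only [Prod.mk.injEq] at heq ⊢
  exact ⟨congrArg Subtype.val heq.1, congrArg Subtype.val heq.2⟩

end SaddlePoint

lemma integrable_inner_of_memLp {X F : Type*} [MeasurableSpace X] {μ : Measure X}
    [NormedAddCommGroup F] [InnerProductSpace ℝ F] {f g : X → F} (hf : MemLp f 2 μ)
    (hg : MemLp g 2 μ) : Integrable (fun x => inner ℝ (f x) (g x)) μ :=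
  (hf.norm.integrable_mul hg.norm).mono' (hf.1.inner hg.1)
    (Eventually.of_forall fun x => norm_inner_le_norm (f x) (g x))

namespace Mesh

variable {d : ℕ} {Ω : Set (E d)} {T : Mesh d Ω}

variable (T) in
/-- `Q_h` as a subspace: the mean of `q` over `Ω` is a multiple of `∑ K, |K| q K`. -/
noncomputable def QhSubmodule : Submodule ℝ T.ScalP0 :=
  LinearMap.ker (Fintype.linearCombination ℝ T.elemVol)

lemma mem_QhSubmodule (hΩ : interior (closure Ω) = Ω) {q : T.ScalP0} :
    q ∈ T.QhSubmodule ↔ q ∈ T.Qh := by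
  simp only [mem_Qh_iff hΩ, QhSubmodule, LinearMap.mem_ker, Fintype.linearCombination_apply,
    smul_eq_mul, mul_comm (T.elemVol _)]

/-- The Frobenius product as a bilinear form. -/
noncomputable def frobForm (d : ℕ) : (E d →ₗ[ℝ] E d) →ₗ[ℝ] (E d →ₗ[ℝ] E d) →ₗ[ℝ] ℝ :=
  ∑ i, (innerₗ (E d)).compl₁₂ (LinearMap.applyₗ (EuclideanSpace.single i 1))
    (LinearMap.applyₗ (EuclideanSpace.single i 1))

lemma frobForm_apply (L M : E d →ₗ[ℝ] E d) : frobForm d L M = frob L M := by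
  simp [frobForm, frob]

/-- The gradient of an affine field, as a linear map. -/
noncomputable def linearPart (d : ℕ) : (E d →ᵃ[ℝ] E d) →ₗ[ℝ] E d →ₗ[ℝ] E d where
  toFun := AffineMap.linear
  map_add' := AffineMap.add_linear
  map_smul' := AffineMap.smul_linear

/-- The traces at the point `x` of a piecewise affine field. -/
noncomputable def traceAt (T : Mesh d Ω) (x : E d) : T.VecP1 →ₗ[ℝ] T.elems → E d where
  toFun v K := v K x
  map_add' _ _ := rfl
  map_smul' _ _ := rfl

/-- The traces of the derivative of a piecewise affine field in the direction `z`. -/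
noncomputable def derivTrace (T : Mesh d Ω) (z : E d) : T.VecP1 →ₗ[ℝ] T.elems → E d where
  toFun v K := (v K).linear z
  map_add' _ _ := rfl
  map_smul' _ _ := rfl

section FaceForm

variable [NeZero d] {X Y : Type*} [AddCommGroup X] [Module ℝ X] [AddCommGroup Y] [Module ℝ Y]

/-- The integral over the face `e` of a continuous family of bilinear forms. -/
noncomputable def faceForm (e : T.faces) (B : E d → X →ₗ[ℝ] Y →ₗ[ℝ] ℝ)
    (hB : ∀ u v, Continuous fun x => B x u v) : X →ₗ[ℝ] Y →ₗ[ℝ] ℝ :=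
  LinearMap.mk₂ ℝ (fun u v => T.faceIntegral e fun x => B x u v)
    (fun u u' v => by
      simp only [map_add, LinearMap.add_apply, faceIntegral_add e (hB u v) (hB u' v)])
    (fun c u v => by
      simp only [map_smul, LinearMap.smul_apply, smul_eq_mul, faceIntegral_const_mul])
    (fun u v v' => by simp only [map_add, faceIntegral_add e (hB u v) (hB u v')])
    (fun c u v => by simp only [map_smul, smul_eq_mul, faceIntegral_const_mul])

lemma faceForm_apply (e : T.faces) (B : E d → X →ₗ[ℝ] Y →ₗ[ℝ] ℝ)
    (hB : ∀ u v, Continuous fun x => B x u v) (u : X) (v : Y) :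
    faceForm e B hB u v = T.faceIntegral e fun x => B x u v :=
  rfl

end FaceForm

namespace Orientation

variable (O : T.Orientation)

section AverageAndJump

variable {F : Type*} [AddCommGroup F] [Module ℝ F]

/-- The average on `e` as a linear map. -/
noncomputable def avgHom (e : T.faces) : (T.elems → F) →ₗ[ℝ] F where
  toFun := O.avg e
  map_add' y z := by
    unfold avg
    split_ifs
    · rw [← smul_add, Pi.add_apply, Pi.add_apply, add_add_add_comm]
    · rfl
  map_smul' c y := by
    unfold avg
    split_ifs
    · rw [Pi.smul_apply, Pi.smul_apply, ← smul_add, smul_comm, RingHom.id_apply]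
    · rfl

/-- The jump on `e` as a linear map. -/
noncomputable def jumpHom (e : T.faces) : (T.elems → F) →ₗ[ℝ] F where
  toFun := O.jump e
  map_add' y z := by
    unfold jump
    split_ifs
    · exact add_sub_add_comm _ _ _ _
    · rfl
  map_smul' c y := by
    unfold jump
    split_ifs
    · exact (smul_sub c _ _).symm
    · rfl

end AverageAndJump

section BilinearForms

variable [NeZero d]

/-- `consistency` as a bilinear form. -/
noncomputable def consistencyForm : T.VecP1 →ₗ[ℝ] T.VecP1 →ₗ[ℝ] ℝ :=
  ∑ e : T.faces, faceForm e
    (fun x => (innerₗ (E d)).compl₁₂ (O.avgHom e ∘ₗ T.derivTrace (O.normal e))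
      (O.jumpHom e ∘ₗ T.traceAt x))
    fun _ w => continuous_const.inner (continuous_jump O w e)

lemma consistencyForm_apply (v w : T.VecP1) : O.consistencyForm v w = O.consistency v w := by
  rw [consistencyForm, LinearMap.sum_apply, LinearMap.sum_apply]
  rfl

/-- `a` as a bilinear form. -/
noncomputable def aForm (ν ρ : ℝ) : T.VecP1 →ₗ[ℝ] T.VecP1 →ₗ[ℝ] ℝ :=
  ν • ((∑ K : T.elems, T.elemVol K • (frobForm d).compl₁₂ (linearPart d ∘ₗ LinearMap.proj K)
      (linearPart d ∘ₗ LinearMap.proj K))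
    - O.consistencyForm - O.consistencyForm.flip
    + ρ • ∑ e : T.faces, faceForm e
      (fun x => (T.faceSize e)⁻¹ • ((innerₗ (E d)).compl₁₂ (O.jumpHom e ∘ₗ T.traceAt x)
        (O.jumpHom e ∘ₗ T.traceAt x)).flip)
      fun v w => continuous_const.mul ((continuous_jump O w e).inner (continuous_jump O v e)))

lemma aForm_apply (ν ρ : ℝ) (v w : T.VecP1) : O.aForm ν ρ v w = O.a ν ρ v w := by
  simp only [aForm, a, elemIntegral_const, ← frobForm_apply, ← consistencyForm_apply,
    LinearMap.smul_apply, LinearMap.add_apply, LinearMap.sub_apply, LinearMap.sum_apply,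
    LinearMap.flip_apply, smul_eq_mul, faceForm_apply]
  rfl

/-- `b` as a bilinear form. -/
noncomputable def bForm : T.VecP1 →ₗ[ℝ] T.ScalP0 →ₗ[ℝ] ℝ :=
  (∑ K : T.elems, T.elemVol K • (LinearMap.mul ℝ ℝ).compl₁₂
      (LinearMap.trace ℝ (E d) ∘ₗ linearPart d ∘ₗ LinearMap.proj K) (LinearMap.proj K))
    - ∑ e : T.faces, faceForm e
      (fun x => (LinearMap.mul ℝ ℝ).compl₁₂
        ((innerₗ (E d)).flip (O.normal e) ∘ₗ O.jumpHom e ∘ₗ T.traceAt x) (O.avgHom e))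
      fun w _ => ((continuous_jump O w e).inner continuous_const).mul continuous_const

lemma bForm_apply (w : T.VecP1) (q : T.ScalP0) : O.bForm w q = O.b w q := by
  simp only [bForm, b, elemIntegral_const, LinearMap.sub_apply, LinearMap.sum_apply,
    LinearMap.smul_apply, smul_eq_mul]
  rfl

end BilinearForms

section LoadFunctional

lemma reconTrace_add (v v' : T.VecP1) (e : T.faces) :
    O.reconTrace (v + v') e = O.reconTrace v e + O.reconTrace v' e := by
  have havg : O.avg e (v + v') = O.avg e v + O.avg e v' := (O.avgHom e).map_add v v'
  unfold reconTrace
  split_ifs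
  · rw [havg]
    ext x
    exact inner_add_right (O.normal e) _ _
  · rw [add_zero]

lemma reconTrace_smul (c : ℝ) (v : T.VecP1) (e : T.faces) :
    O.reconTrace (c • v) e = c • O.reconTrace v e := by
  have havg : O.avg e (c • v) = c • O.avg e v := (O.avgHom e).map_smul c v
  unfold reconTrace
  split_ifs
  · rw [havg]
    ext x
    exact real_inner_smul_right (O.normal e) _ _
  · rw [smul_zero]

variable [NeZero d]

lemma isReconstruction_recon (hΩ : interior (closure Ω) = Ω) (v : T.VecP1) :
    O.IsReconstruction v (O.recon v) := by
  rw [recon, dif_pos (O.existsUnique_isReconstruction hΩ v).exists]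
  exact Exists.choose_spec _

lemma recon_eq (hΩ : interior (closure Ω) = Ω) {v w : T.VecP1} (h : O.IsReconstruction v w) :
    O.recon v = w :=
  (O.existsUnique_isReconstruction hΩ v).unique (O.isReconstruction_recon hΩ v) h

lemma recon_add (hΩ : interior (closure Ω) = Ω) (v v' : T.VecP1) :
    O.recon (v + v') = O.recon v + O.recon v' := by
  have h := (O.isReconstruction_iff hΩ).1 (O.isReconstruction_recon hΩ v)
  have h' := (O.isReconstruction_iff hΩ).1 (O.isReconstruction_recon hΩ v')
  refine O.recon_eq hΩ ((O.isReconstruction_iff hΩ).2 fun e K he x hx => ?_)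
  rw [reconTrace_add]
  exact (inner_add_left _ _ _).trans (congrArg₂ (· + ·) (h e K he hx) (h' e K he hx))

lemma recon_smul (hΩ : interior (closure Ω) = Ω) (c : ℝ) (v : T.VecP1) :
    O.recon (c • v) = c • O.recon v := by
  have h := (O.isReconstruction_iff hΩ).1 (O.isReconstruction_recon hΩ v)
  refine O.recon_eq hΩ ((O.isReconstruction_iff hΩ).2 fun e K he x hx => ?_)
  rw [reconTrace_smul]
  exact (real_inner_smul_left _ _ _).trans (congrArg (c * ·) (h e K he hx))

/-- The right-hand side of the scheme as a linear functional. -/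
noncomputable def loadForm (hΩ : interior (closure Ω) = Ω) {f : E d → E d}
    (hf : MemLp f 2 (volume.restrict Ω)) : T.VecP1 →ₗ[ℝ] ℝ where
  toFun v := ∫ x in Ω, inner ℝ (f x) (T.vecFun (O.recon v) x)
  map_add' v v' := by
    have hint (w : T.VecP1) : IntegrableOn (fun x => inner ℝ (f x) (T.vecFun w x)) Ω :=
      integrable_inner_of_memLp hf (memLp_glue fun K => (w K).continuous_of_finiteDimensional)
    rw [← integral_add (hint _) (hint _)]
    simp only [O.recon_add hΩ, vecFun_add, Pi.add_apply, inner_add_right]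
  map_smul' c v := by
    simp only [O.recon_smul hΩ, vecFun_smul, Pi.smul_apply, real_inner_smul_right,
      integral_const_mul, RingHom.id_apply, smul_eq_mul]

lemma loadForm_apply (hΩ : interior (closure Ω) = Ω) {f : E d → E d}
    (hf : MemLp f 2 (volume.restrict Ω)) (v : T.VecP1) :
    O.loadForm hΩ hf v = ∫ x in Ω, inner ℝ (f x) (T.vecFun (O.recon v) x) :=
  rfl

end LoadFunctional

theorem existsUnique_isSolution [d.AtLeastTwo] (hΩ : interior (closure Ω) = Ω)
    (hconn : IsConnected Ω) {σ : ℝ} (hσ : T.IsShapeRegular σ) {ν ρ : ℝ} (hν : 0 < ν)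
    (hρ : penaltyThreshold d σ ≤ ρ) {f : E d → E d} (hf : MemLp f 2 (volume.restrict Ω)) :
    ∃! up : T.VecP1 × T.ScalP0, O.IsSolution ν ρ f up.1 up.2 := by
  have hsaddle := existsUnique_saddlePoint_submodule (O.aForm ν ρ) O.bForm T.VhSubmodule
    T.QhSubmodule ?_ (O.loadForm hΩ hf)
  · simpa only [IsSolution, aForm_apply, bForm_apply, loadForm_apply, mem_VhSubmodule,
      mem_QhSubmodule hΩ] using hsaddle
  simp only [aForm_apply, bForm_apply, mem_VhSubmodule, mem_QhSubmodule hΩ]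
  intro u hu p hp hmom hdiv
  have hu0 : u = 0 := by
    have huu := hmom u hu
    rw [hdiv p hp, sub_zero] at huu
    exact O.eq_zero_of_a_self hΩ hconn hσ hν hρ huu
  refine ⟨hu0, eq_zero_of_mem_Qh hΩ hconn.nonempty hp
    (O.eq_of_b_enrichment hΩ hconn.isPreconnected ?_)⟩
  have htest := hmom _ (T.Dh_subset_Vh (enrichment_mem_Dh fun K => p K / T.elemVol K))
  rwa [hu0, ← aForm_apply, map_zero, LinearMap.zero_apply, zero_sub, neg_eq_zero] at htest

end Orientation

end Mesh

end StokesEG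

open StokesEG in
theorem mainTheorem2_general (d : ℕ) (hd : 2 ≤ d) (σ : ℝ) :
    ∃ ρ₀ : ℝ, 0 < ρ₀ ∧
      ∀ (Ω : Set (E d)), IsConnected Ω → interior (closure Ω) = Ω →
      ∀ (T : Mesh d Ω), T.IsShapeRegular σ → ∀ (O : T.Orientation),
        (∀ v : T.VecP1, ∃! w : T.VecP1, O.IsReconstruction v w) ∧
        ∀ (ν ρ : ℝ), 0 < ν → ρ₀ ≤ ρ →
          ∀ f : E d → E d, MemLp f 2 (volume.restrict Ω) →
            ∃! up : T.VecP1 × T.ScalP0, O.IsSolution ν ρ f up.1 up.2 := by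
  have : d.AtLeastTwo := ⟨hd⟩
  exact ⟨Mesh.Orientation.penaltyThreshold d σ, Mesh.Orientation.penaltyThreshold_pos d σ,
    fun Ω hconn hΩ T hσ O => ⟨O.existsUnique_isReconstruction hΩ,
      fun ν ρ hν hρ f hf => O.existsUnique_isSolution hΩ hconn hσ hν hρ hf⟩⟩

open StokesEG MeasureTheory in
/-- Well-posedness of the pressure-robust enriched Galerkin scheme: the threshold `ρ₀` depends only
on the dimension and on the shape-regularity constant `σ`. The first part of the conclusion says
that the velocity reconstruction in the right-hand side of the scheme is well defined. -/
theorem mainTheorem2 (d : ℕ) (hd : d = 2 ∨ d = 3) (σ : ℝ) :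
    ∃ ρ₀ : ℝ, 0 < ρ₀ ∧
      ∀ (Ω : Set (E d)), IsOpen Ω → Bornology.IsBounded Ω → IsConnected Ω →
        interior (closure Ω) = Ω →
      ∀ (T : Mesh d Ω), T.IsShapeRegular σ → ∀ (O : T.Orientation),
        (∀ v ∈ T.Vh, ∃! w : T.VecP1, O.IsReconstruction v w) ∧
        ∀ (ν ρ : ℝ), 0 < ν → ρ₀ ≤ ρ →
          ∀ f : E d → E d, MemLp f 2 (volume.restrict Ω) →
            ∃! up : T.VecP1 × T.ScalP0, O.IsSolution ν ρ f up.1 up.2 := by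
  obtain ⟨ρ₀, hρ₀, h⟩ := mainTheorem2_general d (by omega) σ
  exact ⟨ρ₀, hρ₀, fun Ω _ _ hconn hΩ T hσ O =>
    (h Ω hconn hΩ T hσ O).imp_left fun hrecon v _ => hrecon v⟩
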